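/- **Theorem.** Let $(\Gamma,\mu)$ be an infinite connected graph without loops and multiple edges, with symmetric weights $\mu_{x,y}=\mu_{y,x}$, positive exactly when $x\sim y$, and $\mu(x)=\sum_{y\sim x}\mu_{x,y}<\infty$ for every $x$. Let $(X_n)$ be the random walk with transition probabilities $P(x,y)=\mu_{x,y}/\mu(x)$, and let $\mathbb P_x,\mathbb E_x$ refer to the walk started at $X_0=x$. Let $d$ be the graph distance, $B(x,R)=\{y:d(x,y)<R\}$ and $S(x,R)=\{y:d(x,y)=R\}$ for real $R>0$, let $\pi_{x,y}$ be the set of all vertices on shortest paths from $x$ to $y$, $T_A=\inf\{t\ge 0:X_t\notin A\}$, $T_{x,R}=T_{B(x,R)}$ and $E(x,R)=\mathbb E_x(T_{x,R})$. Assume $(p_0)$ there is $p_0>0$ such that $P(x,y)\ge p_0$ for all $x\sim y$. For $q,Q>0$, $x,y\in\Gamma$, $n\in\mathbb N$ and real $R>0$ with $n\ge R$ define the following. * $k_q(x,n,R)$ is the maximal integer $k$ with $1\le k\le R$ and $\frac nk\le q\min_{z\in B(x,R)}E\left(z,\frac Rk\right)$; put $k_q(x,n,R)=1$ if there is no such integer.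 * $l_9(x,y,n,R)$ is the minimal integer $l\ge1$ with $\frac nl\ge Q\max_{z\in\pi_{x,y}}E\left(z,\frac{9R}l\right)$; put $l_9(x,y,n,R)=R$ if there is no such integer. * If $2R$ is an integer, $\nu_Q(x,n,R)=\min_{y\in S(x,2R)}l_9(x,y,n,R)$. 1. Suppose that condition $(\overline E)$ holds: there is $C_0>0$ such that $\max_{y\in B(x,R)}\mathbb E_y(T_{x,R})\le C_0E(x,R)$ for all $x\in\Gamma$ and $R>0$. Then there are constants $q,c,C>0$ such that for all $x\in\Gamma$, real $R>0$ and integers $n\ge R$ $$\mathbb P_x(T_{x,R}<n)\le C\exp\left(-c\,k_q(x,n,R)\right).$$ 2. Suppose that the elliptic Harnack inequality $(H)$ holds: there is $C_0>0$ such that for all $x\in\Gamma$, $R>0$ and every function $u$ that is non-negative on $B(x,2R)$ and its neighbours and harmonic on $B(x,2R)$ (that is, $\sum_yP(z,y)u(y)=u(z)$ for $z\in B(x,2R)$), $\max_{B(x,R)}u\le C_0\min_{B(x,R)}u$. Then there are constants $Q,c,C>0$ such that for all $x\in\Gamma$, all $R>0$ with $2R$ an integer (in particular all positive integers $R$), and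 all integers $n\ge R+1$ $$\mathbb P_x(T_{x,R}<n)\ge c\exp\left(-C\,\nu_Q(x,n,R)\right).$$ -/

import Mathlib

open MeasureTheory ProbabilityTheory
open scoped ENNReal NNReal

noncomputable section

/-- An infinite connected weighted graph, without loops and multiple edges: a connected simple
graph on `V` (in all uses below `V` is infinite), with symmetric weights, positive exactly on the
edges, and of finite total weight `μ(x) = ∑_{y ∼ x} μ_{x,y}` at every vertex. -/
structure WeightedGraph (V : Type*) where
  graph : SimpleGraph V
  connected : graph.Connected
  weight : V → V → ℝ≥0
  weight_symm : ∀ x y, weight x y = weight y x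
  weight_pos_iff : ∀ x y, 0 < weight x y ↔ graph.Adj x y
  tsum_weight_ne_top : ∀ x, ∑' y, (weight x y : ℝ≥0∞) ≠ ∞

namespace WeightedGraph

variable {V : Type*} (G : WeightedGraph V)

/-- The vertex measure `μ(x) = ∑_{y ∼ x} μ_{x,y}`. -/
def mu (x : V) : ℝ≥0∞ := ∑' y, (G.weight x y : ℝ≥0∞)

theorem mu_ne_zero [Infinite V] (x : V) : G.mu x ≠ 0 := by
  obtain ⟨y, hy⟩ := G.connected.preconnected.exists_adj_of_nontrivial x
  have h := (G.weight_pos_iff x y).2 hy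
  intro h0
  have := ENNReal.tsum_eq_zero.1 h0 y
  simp only [ENNReal.coe_eq_zero] at this
  exact h.ne' this

/-- The one-step distribution from `x`, with probabilities `P(x,y) = μ_{x,y} / μ(x)`. -/
def step [Infinite V] (x : V) : PMF V :=
  PMF.normalize (fun y => (G.weight x y : ℝ≥0∞)) (G.mu_ne_zero x) (G.tsum_weight_ne_top x)

theorem step_apply [Infinite V] (x y : V) : G.step x y = G.weight x y / G.mu x := rfl

/-- Condition `(p₀)`: the one-step transition probabilities along edges are bounded below. -/
def P0 [Infinite V] : Prop :=
  ∃ p₀ : ℝ≥0, 0 < p₀ ∧ ∀ x y, G.graph.Adj x y → (p₀ : ℝ≥0∞) ≤ G.step x y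

/-- The open ball `B(x,R) = {y : d(x,y) < R}` of the graph distance. -/
def ball (x : V) (R : ℝ) : Set V := {y | (G.graph.dist x y : ℝ) < R}

/-- The sphere `S(x,R) = {y : d(x,y) = R}` of the graph distance. -/
def sphere (x : V) (R : ℝ) : Set V := {y | (G.graph.dist x y : ℝ) = R}

/-- `π_{x,y}`: the union of the vertices of the shortest paths from `x` to `y`. -/
def geodesics (x y : V) : Set V :=
  {z | ∃ p : G.graph.Walk x y, p.length = G.graph.dist x y ∧ z ∈ p.support}

/-- `A` together with all neighbours of its vertices. -/
def closure (A : Set V) : Set V := A ∪ {y | ∃ x ∈ A, G.graph.Adj x y}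

/-- `h` is harmonic on `A`: `∑_y P(x,y) h(y) = h(x)` for all `x ∈ A`.
Only the values of `h` on `G.closure A` matter. -/
def HarmonicOn [Infinite V] (h : V → ℝ) (A : Set V) : Prop :=
  ∀ x ∈ A, HasSum (fun y => (G.step x y).toReal * h y) (h x)

/-- The elliptic Harnack inequality `(H)`. -/
def EllipticHarnack [Infinite V] : Prop :=
  ∃ C : ℝ, 0 < C ∧ ∀ (x : V) (R : ℝ), 0 < R → ∀ u : V → ℝ,
    (∀ y ∈ G.closure (G.ball x (2 * R)), 0 ≤ u y) → G.HarmonicOn u (G.ball x (2 * R)) →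
    ∀ y ∈ G.ball x R, ∀ z ∈ G.ball x R, u y ≤ C * u z

/-- The exit time `T_A = inf {t ≥ 0 : X_t ∉ A}` on the space of trajectories. -/
def exitTime (A : Set V) (ω : ℕ → V) : ℕ∞ := ⨅ (t : ℕ) (_ : ω t ∉ A), (t : ℕ∞)

variable [Infinite V] [MeasurableSpace V] [DiscreteMeasurableSpace V]

/-- The transition kernel of the random walk. -/
def kernel : Kernel V V where
  toFun x := (G.step x).toMeasure
  measurable' := Measurable.of_discrete

instance : IsMarkovKernel G.kernel := ⟨fun x => PMF.toMeasure.isProbabilityMeasure (G.step x)⟩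

/-- The step from time `n` to time `n + 1` of the Markov chain, given the past. -/
def chainKernel (n : ℕ) : Kernel (Finset.Iic n → V) V :=
  G.kernel.comap (fun h => h ⟨n, Finset.mem_Iic.2 le_rfl⟩) (measurable_pi_apply _)

instance (n : ℕ) : IsMarkovKernel (G.chainKernel n) := by
  unfold chainKernel; infer_instance

/-- The law `ℙ_x` of the random walk `(X_n)` started at `X_0 = x`, on the trajectories `ℕ → V`. -/
def law (x : V) : Measure (ℕ → V) :=
  Kernel.traj (X := fun _ => V) G.chainKernel 0 (fun _ => x)

/-- The mean exit time `E_y(A) = 𝔼(T_A | X_0 = y)`. -/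
def meanExit (A : Set V) (y : V) : ℝ≥0∞ := ∫⁻ ω, (exitTime A ω : ℝ≥0∞) ∂(G.law y)

/-- `E(x,R) = E_x(B(x,R))`. -/
def E (x : V) (R : ℝ) : ℝ≥0∞ := G.meanExit (G.ball x R) x

/-- The maximal mean exit time `max_{y ∈ B(x,R)} E_y(B(x,R))`. -/
def Ebar (x : V) (R : ℝ) : ℝ≥0∞ := ⨆ y ∈ G.ball x R, G.meanExit (G.ball x R) y

/-- Condition `(Ē)`. -/
def EbarCondition : Prop :=
  ∃ C : ℝ≥0, 0 < C ∧ ∀ (x : V) (R : ℝ), 0 < R → G.Ebar x R ≤ C * G.E x R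

/-- `k(x,n,R)`, for the constant `q`: the maximal integer `1 ≤ k ≤ R` such that
`n / k ≤ q min_{z ∈ B(x,R)} E(z, R / k)`, and `1` if there is none
(the supremum of the empty set of natural numbers is `0`). -/
def k (q : ℝ≥0) (x : V) (n : ℕ) (R : ℝ) : ℕ :=
  max 1 (sSup {k : ℕ | 1 ≤ k ∧ (k : ℝ) ≤ R ∧
    (n : ℝ≥0∞) / k ≤ q * ⨅ z ∈ G.ball x R, G.E z (R / k)})

open Classical in
/-- `l_C(x,y,n,R)`, for the constant `Q`: the minimal integer `l ≥ 1` such that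
`n / l ≥ Q max_{z ∈ π_{x,y}} E(z, C R / l)`, and `R` if there is none. -/
def l (Q : ℝ≥0) (C : ℝ) (x y : V) (n : ℕ) (R : ℝ) : ℝ :=
  if h : ∃ l : ℕ, 1 ≤ l ∧
      (Q : ℝ≥0∞) * ⨆ z ∈ G.geodesics x y, G.E z (C * R / l) ≤ (n : ℝ≥0∞) / l
  then (Nat.find h : ℝ) else R

/-- `ν(x,n,R) = min_{y ∈ S(x,2R)} l_9(x,y,n,R)`, for the constant `Q`. -/
def nu (Q : ℝ≥0) (x : V) (n : ℕ) (R : ℝ) : ℝ :=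
  sInf ((fun y => G.l Q 9 x y n R) '' G.sphere x (2 * R))

end WeightedGraph

end

/-! Both bounds are potential theory on finite sets. By (p₀) balls are finite, first-step equations
turn exit probabilities and mean exit times into relations for the averaging operator P, and the
minimum principle `P0.nonneg_of_superharmonic` compares solutions.

Upper bound. Let D = B(z,r) and ψ = 1 − a·E_·(D) with a = 1/(2C·E_z(D)). Then ψ ≥ 1/2 by (Ē), ψ = 1
off D, and Pψ = ψ + a in D. So sPψ ≤ ψ for s close enough to 1, which bounds the Laplace transform
of the exit time from D: 𝔼_z s^{T_D} ≤ ψ(z) = 1 − 1/(2C). Leaving B(x,R) forces about R/r such exits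
in succession, and `P0.exitProb_le_of_stages` multiplies the gains. With r = R/k and s = exp(−δk/n),
the loss s^{-n} = exp(δk) is smaller than the gain of k/2 stages.

Lower bound. On a geodesic from x to S(x,2R), place balls of radius comparable to R/l; visiting at
most 6l of them in turn leads out of B(x,R). By (H) and the symmetry of Green functions each visit
has probability at least C^{-60} (`HarnackWith.le_hitting`). Time is controlled by Markov's
inequality, ℙ(event, time < n) ≥ ℙ(event) − 𝔼(time; event)/n, kept linear in `P0.sub_le_exitProb`.
The difficulty is that mean exit times are bounded only at the centres, and (H) does not apply to
them because they are not harmonic. They are therefore replaced by their harmonic extension into a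
smaller ball, and the time spent in that ball is charged to the previous domain of the chain, which
contains it (`HarnackWith.exitProb_ge_of_chain`). If l is comparable to R, walking straight out
costs only about p₀^R. -/

noncomputable section

namespace WeightedGraph

/-! ### From trajectories to the averaging operator. -/

section

variable {V : Type*} (G : WeightedGraph V)

/-! ### Local finiteness and the averaging operator -/

section Averaging

variable [Infinite V]

theorem step_ne_zero_iff (x y : V) : G.step x y ≠ 0 ↔ G.graph.Adj x y := by
  rw [step_apply, ← G.weight_pos_iff]
  simp [ENNReal.div_eq_zero_iff, mu, G.tsum_weight_ne_top x, pos_iff_ne_zero]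

variable {G} in
-- The transition probabilities to the neighbours are at least p₀ and have sum 1.
theorem P0.finite_neighborSet (hp : G.P0) (x : V) : (G.graph.neighborSet x).Finite := by
  obtain ⟨p, hp0, h⟩ := hp
  have hs : ∑' y, G.step x y ≠ ∞ := by rw [PMF.tsum_coe]; exact ENNReal.one_ne_top
  refine (ENNReal.finite_const_le_of_tsum_ne_top hs (ε := p) ?_).subset ?_
  · simpa using hp0.ne'
  · intro y hy
    exact h x y hy

open Classical in
/-- The finite set of neighbours of a vertex of finite degree. -/
def nbrs (x : V) : Finset V :=
  if h : (G.graph.neighborSet x).Finite then h.toFinset else ∅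

/-- The transition probability as a real number. -/
def p (x y : V) : ℝ := (G.step x y).toReal

/-- The transition operator `f ↦ ∑_y P(x,y) f(y)` of a locally finite weighted graph. -/
def avg (f : V → ℝ) (x : V) : ℝ := ∑ y ∈ G.nbrs x, G.p x y * f y

theorem p_nonneg (x y : V) : 0 ≤ G.p x y := ENNReal.toReal_nonneg

variable {G} in
theorem P0.mem_nbrs (hp : G.P0) {x y : V} : y ∈ G.nbrs x ↔ G.graph.Adj x y := by
  simp [nbrs, hp.finite_neighborSet x]

theorem p_pos {x y : V} (h : G.graph.Adj x y) : 0 < G.p x y :=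
  ENNReal.toReal_pos ((G.step_ne_zero_iff x y).2 h) (PMF.apply_ne_top _ _)

theorem p_eq_zero {x y : V} (h : ¬ G.graph.Adj x y) : G.p x y = 0 := by
  have : G.step x y = 0 := by
    by_contra h'
    exact h ((G.step_ne_zero_iff x y).1 h')
  simp [p, this]

variable {G} in
theorem P0.hasSum_avg (hp : G.P0) (f : V → ℝ) (x : V) :
    HasSum (fun y => (G.step x y).toReal * f y) (G.avg f x) := by
  refine hasSum_sum_of_ne_finset_zero fun y hy => ?_
  rw [hp.mem_nbrs] at hy
  have := G.p_eq_zero hy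
  rw [p] at this
  rw [this, zero_mul]

variable {G} in
theorem P0.sum_p (hp : G.P0) (x : V) : ∑ y ∈ G.nbrs x, G.p x y = 1 := by
  have h1 : HasSum (fun y => (G.step x y).toReal * 1) 1 := by
    simp only [mul_one]
    have := ENNReal.hasSum_toReal (f := G.step x) (by simp)
    rwa [← ENNReal.tsum_toReal_eq (fun y => PMF.apply_ne_top _ _), PMF.tsum_coe,
      ENNReal.toReal_one] at this
  have h2 := (hp.hasSum_avg (fun _ => 1) x).unique h1
  simpa [avg] using h2

theorem avg_mono {f g : V → ℝ} {x : V} (h : ∀ y ∈ G.nbrs x, f y ≤ g y) :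
    G.avg f x ≤ G.avg g x :=
  Finset.sum_le_sum fun y hy => mul_le_mul_of_nonneg_left (h y hy) (G.p_nonneg x y)

theorem avg_congr {f g : V → ℝ} {x : V} (h : ∀ y ∈ G.nbrs x, f y = g y) :
    G.avg f x = G.avg g x :=
  Finset.sum_congr rfl fun y hy => by rw [h y hy]

theorem avg_add (f g : V → ℝ) (x : V) : G.avg (fun y => f y + g y) x = G.avg f x + G.avg g x := by
  simp [avg, mul_add, Finset.sum_add_distrib]

theorem avg_sub (f g : V → ℝ) (x : V) : G.avg (fun y => f y - g y) x = G.avg f x - G.avg g x := by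
  simp [avg, mul_sub, Finset.sum_sub_distrib]

theorem avg_smul (a : ℝ) (f : V → ℝ) (x : V) : G.avg (fun y => a * f y) x = a * G.avg f x := by
  simp only [avg, Finset.mul_sum]
  exact Finset.sum_congr rfl fun y _ => by ring

variable {G} in
theorem P0.avg_const (hp : G.P0) (a : ℝ) (x : V) : G.avg (fun _ => a) x = a := by
  simp [avg, ← Finset.sum_mul, hp.sum_p x]

theorem avg_nonneg {f : V → ℝ} {x : V} (h : ∀ y ∈ G.nbrs x, 0 ≤ f y) : 0 ≤ G.avg f x :=
  Finset.sum_nonneg fun y hy => mul_nonneg (G.p_nonneg x y) (h y hy)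

end Averaging

/-! ### Survival probabilities of the random walk -/

theorem lt_exitTime_iff {A : Set V} {ω : ℕ → V} {n : ℕ} :
    (n : ℕ∞) < exitTime A ω ↔ ∀ i ≤ n, ω i ∈ A := by
  constructor
  · intro h i hi
    by_contra hc
    have h1 : exitTime A ω ≤ (i : ℕ∞) := iInf₂_le (f := fun (t : ℕ) (_ : ω t ∉ A) => (t : ℕ∞)) i hc
    exact absurd (h.trans_le h1) (by simpa using hi)
  · intro h
    have : ((n + 1 : ℕ) : ℕ∞) ≤ exitTime A ω := by
      refine le_iInf₂ fun t ht => ?_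
      have : n < t := by
        by_contra hc
        exact ht (h t (not_lt.1 hc))
      exact_mod_cast this
    exact lt_of_lt_of_le (by exact_mod_cast Nat.lt_succ_self n) this

theorem exitTime_lt_iff {A : Set V} {ω : ℕ → V} {n : ℕ} :
    exitTime A ω < (n : ℕ∞) ↔ ¬ ∀ i < n, ω i ∈ A := by
  cases n with
  | zero => simp
  | succ n =>
    have h1 : (exitTime A ω < ((n + 1 : ℕ) : ℕ∞)) ↔ ¬ ((n : ℕ∞) < exitTime A ω) := by
      rw [not_lt]
      push_cast
      exact ENat.lt_add_one_iff (ENat.natCast_ne_top n)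
    rw [h1, lt_exitTime_iff]
    simp

theorem _root_.ENat.toENNReal_eq_tsum (t : ℕ∞) :
    (t : ℝ≥0∞) = ∑' n : ℕ, if (n : ℕ∞) < t then 1 else 0 := by
  induction t using ENat.recTopCoe with
  | top => simp
  | coe m =>
    rw [tsum_eq_sum (s := Finset.range m)]
    · rw [Finset.sum_congr rfl (g := fun _ => 1)]
      · simp
      · intro n hn
        simp [Finset.mem_range.1 hn]
    · intro n hn
      simpa using hn

theorem measurableSet_stay [MeasurableSpace V] [DiscreteMeasurableSpace V] (A : Set V) (n : ℕ) :
    MeasurableSet {ω : ℕ → V | ∀ i < n, ω i ∈ A} := by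
  have : {ω : ℕ → V | ∀ i < n, ω i ∈ A} = ⋂ i : ℕ, ⋂ _ : i < n, (fun ω => ω i) ⁻¹' A := by
    ext; simp
  rw [this]
  exact .iInter fun i => .iInter fun _ => (measurable_pi_apply i) (MeasurableSet.of_discrete)

variable [Infinite V] [MeasurableSpace V] [DiscreteMeasurableSpace V]

instance (x : V) : IsProbabilityMeasure (G.law x) := by
  unfold law; infer_instance

/-- The transition operator of the walk killed outside `A`. -/
def killed (A : Set V) (f : V → ℝ≥0∞) : V → ℝ≥0∞ :=
  A.indicator fun x => ∫⁻ y, f y ∂(G.kernel x)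

theorem lintegral_law_zero (f : V → ℝ≥0∞) (x : V) :
    ∫⁻ ω, f (ω 0) ∂(G.law x) = f x := by
  have hf : Measurable f := .of_discrete
  rw [law, Kernel.lintegral_traj _ (by fun_prop)]
  simp [Function.updateFinset]

/-- The Markov property: the integrand depends on the first n + 2 positions only, and their law is
that of the first n + 1 positions followed by one step of `chainKernel n`. Integrating out this last
step produces `killed`. -/
theorem lintegral_law_succ (A : Set V) (f : V → ℝ≥0∞) (x : V) (n : ℕ) :
    ∫⁻ ω, {ω : ℕ → V | ∀ i < n + 1, ω i ∈ A}.indicator (fun ω => f (ω (n + 1))) ω ∂(G.law x) =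
      ∫⁻ ω, {ω : ℕ → V | ∀ i < n, ω i ∈ A}.indicator (fun ω => G.killed A f (ω n)) ω
        ∂(G.law x) := by
  have hf : Measurable f := .of_discrete
  let S : Set (Finset.Iic n → V) := {h | ∀ i, h i ∈ A}
  have hS : MeasurableSet S := by
    have : S = ⋂ i, (fun h => h i) ⁻¹' A := by ext; simp [S]
    rw [this]
    exact .iInter fun i => (measurable_pi_apply i) (MeasurableSet.of_discrete)
  let F : (Finset.Iic n → V) × V → ℝ≥0∞ := fun z => S.indicator (fun _ => f z.2) z.1
  have hF : Measurable F := by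
    have : F = (Prod.fst ⁻¹' S).indicator (fun z => f z.2) := by
      ext z; rfl
    rw [this]
    exact (hf.comp measurable_snd).indicator (measurable_fst hS)
  have hm := Kernel.partialTraj_compProd_eq_map_traj (X := fun _ => V) (κ := G.chainKernel) (Nat.zero_le n)
    (x₀ := fun _ => x)
  have hmem (ω : ℕ → V) : ω ∈ {ω : ℕ → V | ∀ i < n + 1, ω i ∈ A} ↔
      (Preorder.frestrictLe n ω : Finset.Iic n → V) ∈ S :=
    ⟨fun h i => h i (Nat.lt_succ_of_le (Finset.mem_Iic.1 i.2)),
      fun h i hi => h ⟨i, Finset.mem_Iic.2 (Nat.lt_succ_iff.1 hi)⟩⟩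
  have h1 : ∫⁻ ω, {ω : ℕ → V | ∀ i < n + 1, ω i ∈ A}.indicator (fun ω => f (ω (n + 1))) ω
      ∂(G.law x) = ∫⁻ ω, F (Preorder.frestrictLe n ω, ω (n + 1)) ∂(G.law x) := by
    refine lintegral_congr fun ω => ?_
    by_cases hω : ω ∈ {ω : ℕ → V | ∀ i < n + 1, ω i ∈ A}
    · rw [Set.indicator_of_mem hω]
      simp only [F]
      rw [Set.indicator_of_mem ((hmem ω).1 hω)]
    · rw [Set.indicator_of_notMem hω]
      simp only [F]
      rw [Set.indicator_of_notMem (mt (hmem ω).2 hω)]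
  have h3 : ∫⁻ ω, F (Preorder.frestrictLe n ω, ω (n + 1)) ∂(G.law x) =
      ∫⁻ z, F z ∂((G.law x).map fun ω => (Preorder.frestrictLe n ω, ω (n + 1))) :=
    (lintegral_map hF (by fun_prop)).symm
  have hcyl : (G.law x).map (Preorder.frestrictLe n) = _ :=
    Kernel.traj_map_frestrictLe_apply (X := fun _ => V) (κ := G.chainKernel) 0 n (fun _ => x)
  have hm' : (G.law x).map (fun ω => (Preorder.frestrictLe n ω, ω (n + 1))) = _ := hm.symm
  rw [h1, h3, hm', Measure.lintegral_compProd hF, ← hcyl,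
    lintegral_map (Measurable.lintegral_kernel_prod_right' hF)
      (Preorder.measurable_frestrictLe n)]
  refine lintegral_congr fun ω => ?_
  have h2 : G.chainKernel n (Preorder.frestrictLe n ω) = G.kernel (ω n) := rfl
  rw [h2]
  by_cases hω : ∀ i < n + 1, ω i ∈ A
  · have ha : ω n ∈ A := hω n (Nat.lt_succ_self n)
    have hb : ω ∈ {ω : ℕ → V | ∀ i < n, ω i ∈ A} := fun i hi => hω i (by lia)
    have hc : Preorder.frestrictLe n ω ∈ S := fun i =>
      hω i (Nat.lt_succ_of_le (Finset.mem_Iic.1 i.2))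
    simp [F, killed, ha, Set.indicator_of_mem hb, Set.indicator_of_mem hc]
  · have hc : Preorder.frestrictLe n ω ∉ S := fun h =>
      hω fun i hi => h ⟨i, Finset.mem_Iic.2 (Nat.lt_succ_iff.1 hi)⟩
    have : {ω : ℕ → V | ∀ i < n, ω i ∈ A}.indicator (fun ω => G.killed A f (ω n)) ω = 0 := by
      by_cases hb : ω ∈ {ω : ℕ → V | ∀ i < n, ω i ∈ A}
      · have ha : ω n ∉ A := by
          intro ha
          refine hω fun i hi => ?_
          rcases Nat.lt_succ_iff_lt_or_eq.1 hi with h | rfl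
          exacts [hb i h, ha]
        simp [Set.indicator_of_mem hb, killed, ha]
      · exact Set.indicator_of_notMem hb _
    rw [this]
    simp [F, Set.indicator_of_notMem hc]

theorem lintegral_law_eq_iterate (A : Set V) (n : ℕ) (f : V → ℝ≥0∞) (x : V) :
    ∫⁻ ω, {ω : ℕ → V | ∀ i < n, ω i ∈ A}.indicator (fun ω => f (ω n)) ω ∂(G.law x) =
      (G.killed A)^[n] f x := by
  induction n generalizing f with
  | zero => simpa using G.lintegral_law_zero f x
  | succ n ih => rw [lintegral_law_succ, ih, Function.iterate_succ_apply]

/-- The probability that the first `n` positions of the walk started at `x` lie in `A`. -/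
def surv (A : Set V) (n : ℕ) (x : V) : ℝ≥0∞ := G.law x {ω | ∀ i < n, ω i ∈ A}

theorem surv_eq_iterate (A : Set V) (n : ℕ) : G.surv A n = (G.killed A)^[n] 1 := by
  ext x
  rw [← lintegral_law_eq_iterate, surv, ← lintegral_indicator_one (measurableSet_stay A n)]
  rfl

theorem surv_zero (A : Set V) (x : V) : G.surv A 0 x = 1 := by simp [surv]

theorem surv_succ_of_notMem {A : Set V} {x : V} (hx : x ∉ A) (n : ℕ) : G.surv A (n + 1) x = 0 := by
  rw [surv_eq_iterate, Function.iterate_succ_apply', killed, Set.indicator_of_notMem hx]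

theorem surv_ne_top (A : Set V) (n : ℕ) (x : V) : G.surv A n x ≠ ∞ := measure_ne_top _ _

variable {G} in
theorem P0.lintegral_kernel (hp : G.P0) (f : V → ℝ≥0∞) (x : V) :
    ∫⁻ y, f y ∂(G.kernel x) = ∑ y ∈ G.nbrs x, G.step x y * f y := by
  have h1 : (G.step x).support ⊆ (G.nbrs x : Set V) := fun y hy =>
    hp.mem_nbrs.2 ((G.step_ne_zero_iff x y).1 hy)
  have h2 : G.kernel x = (G.step x).toMeasure := rfl
  have h3 : (G.step x).toMeasure.restrict (G.nbrs x) = (G.step x).toMeasure := by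
    rw [Measure.restrict_eq_self_of_ae_mem]
    rw [ae_iff, PMF.toMeasure_apply_eq_zero_iff _ (.of_discrete)]
    exact Set.disjoint_left.2 fun y hy hy' => hy' (h1 hy)
  rw [h2, ← h3, lintegral_finset]
  exact Finset.sum_congr rfl fun y _ => by
    rw [PMF.toMeasure_apply_singleton _ _ (.of_discrete), mul_comm]

variable {G} in
theorem P0.surv_succ_of_mem (hp : G.P0) {A : Set V} {x : V} (hx : x ∈ A) (n : ℕ) :
    G.surv A (n + 1) x = ∑ y ∈ G.nbrs x, G.step x y * G.surv A n y := by
  rw [surv_eq_iterate, Function.iterate_succ_apply', killed, Set.indicator_of_mem hx,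
    hp.lintegral_kernel, surv_eq_iterate]

/-- The tail sum formula; `surv` with index n + 1 is the probability of T_A > n. -/
theorem meanExit_eq_tsum (A : Set V) (x : V) : G.meanExit A x = ∑' n : ℕ, G.surv A (n + 1) x := by
  have h (ω : ℕ → V) : (exitTime A ω : ℝ≥0∞) =
      ∑' n : ℕ, {ω : ℕ → V | ∀ i < n + 1, ω i ∈ A}.indicator 1 ω := by
    rw [ENat.toENNReal_eq_tsum]
    refine tsum_congr fun n => ?_
    have h' : (n : ℕ∞) < exitTime A ω ↔ ω ∈ {ω : ℕ → V | ∀ i < n + 1, ω i ∈ A} := by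
      rw [lt_exitTime_iff]
      simp
    by_cases hω : (n : ℕ∞) < exitTime A ω
    · rw [if_pos hω, Set.indicator_of_mem (h'.1 hω), Pi.one_apply]
    · rw [if_neg hω, Set.indicator_of_notMem (mt h'.2 hω)]
  rw [meanExit]
  simp_rw [h]
  rw [lintegral_tsum fun n => (measurable_one.indicator (measurableSet_stay A (n + 1))).aemeasurable]
  exact tsum_congr fun n => lintegral_indicator_one (measurableSet_stay A (n + 1))

/-- The probability that the walk started at `x` exits `A` before time `n`. -/
def exitProb (A : Set V) (n : ℕ) (x : V) : ℝ := (G.law x).real {ω | exitTime A ω < n}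

theorem exitProb_eq (A : Set V) (n : ℕ) (x : V) :
    G.exitProb A n x = 1 - (G.surv A n x).toReal := by
  have : {ω : ℕ → V | exitTime A ω < n} = {ω | ∀ i < n, ω i ∈ A}ᶜ := by
    ext ω; exact exitTime_lt_iff
  rw [exitProb, this, probReal_compl_eq_one_sub (measurableSet_stay A n)]
  rfl

theorem exitProb_zero (A : Set V) (x : V) : G.exitProb A 0 x = 0 := by
  simp [exitProb_eq, surv_zero]

theorem exitProb_nonneg (A : Set V) (n : ℕ) (x : V) : 0 ≤ G.exitProb A n x := measureReal_nonneg

theorem exitProb_le_one (A : Set V) (n : ℕ) (x : V) : G.exitProb A n x ≤ 1 := measureReal_le_one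

theorem exitProb_succ_of_notMem {A : Set V} {x : V} (hx : x ∉ A) (n : ℕ) :
    G.exitProb A (n + 1) x = 1 := by
  simp [exitProb_eq, surv_succ_of_notMem _ hx]

variable {G} in
theorem P0.exitProb_succ_of_mem (hp : G.P0) {A : Set V} {x : V} (hx : x ∈ A) (n : ℕ) :
    G.exitProb A (n + 1) x = G.avg (G.exitProb A n) x := by
  have h : G.avg (G.exitProb A n) x = G.avg (fun y => 1 - (G.surv A n y).toReal) x :=
    G.avg_congr fun y _ => exitProb_eq ..
  rw [h, avg_sub, hp.avg_const, exitProb_eq, hp.surv_succ_of_mem hx, ENNReal.toReal_sum]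
  · simp [avg, p]
  · exact fun y _ => ENNReal.mul_ne_top (PMF.apply_ne_top _ _) (G.surv_ne_top A n y)

variable {G} in
theorem P0.avg_exitProb_le (hp : G.P0) (A : Set V) (n : ℕ) (x : V) :
    G.avg (G.exitProb A n) x ≤ G.exitProb A (n + 1) x := by
  by_cases hx : x ∈ A
  · exact (hp.exitProb_succ_of_mem hx n).ge
  · rw [exitProb_succ_of_notMem _ hx, ← hp.avg_const 1 x]
    exact G.avg_mono fun y _ => G.exitProb_le_one A n y

end

/-! ### Potential theory on finite sets. -/

section

variable {V : Type*} (G : WeightedGraph V)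

/-! ### Distances and closed balls -/

/-- The closed ball `{y : d(x,y) ≤ n}`. -/
def cball (x : V) (n : ℕ) : Set V := {y | G.graph.dist x y ≤ n}

theorem mem_cball {x y : V} {n : ℕ} : y ∈ G.cball x n ↔ G.graph.dist x y ≤ n := Iff.rfl

theorem dist_triangle (x y z : V) : G.graph.dist x z ≤ G.graph.dist x y + G.graph.dist y z :=
  G.connected.dist_triangle

theorem exists_between {a b : V} {j : ℕ} (hj : j ≤ G.graph.dist a b) :
    ∃ x, G.graph.dist a x = j ∧ G.graph.dist x b = G.graph.dist a b - j := by
  obtain ⟨w, hw⟩ := G.connected.exists_walk_length_eq_dist a b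
  refine ⟨w.getVert j, ?_⟩
  have h1 := SimpleGraph.dist_le (w.take j)
  have h2 := SimpleGraph.dist_le (w.drop j)
  have h3 := G.dist_triangle a (w.getVert j) b
  rw [SimpleGraph.Walk.take_length] at h1
  rw [SimpleGraph.Walk.drop_length] at h2
  have : min j w.length = j := min_eq_left (by lia)
  lia

theorem exists_adj_of_dist_eq_succ {a b : V} {n : ℕ} (h : G.graph.dist a b = n + 1) :
    ∃ x, G.graph.dist a x = n ∧ G.graph.Adj x b := by
  obtain ⟨x, hx, hx'⟩ := G.exists_between (a := a) (b := b) (j := n) (by lia)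
  exact ⟨x, hx, SimpleGraph.dist_eq_one_iff_adj.1 (by lia)⟩

theorem dist_le_succ_of_adj {x y z : V} (h : G.graph.Adj y z) :
    G.graph.dist x z ≤ G.graph.dist x y + 1 := by
  have := G.dist_triangle x y z
  rwa [SimpleGraph.dist_eq_one_iff_adj.2 h] at this

theorem exists_adj_notMem_of_finite [Infinite V] {M : Set V} (hM : M.Finite) (hne : M.Nonempty) :
    ∃ x ∈ M, ∃ y ∉ M, G.graph.Adj x y := by
  by_contra! hc
  obtain ⟨a, ha⟩ := hne
  obtain ⟨b, hb⟩ := hM.exists_notMem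
  have key : ∀ n : ℕ, ∀ z, G.graph.dist a z = n → z ∈ M := by
    intro n
    induction n with
    | zero =>
      intro z hz
      rw [G.connected.dist_eq_zero_iff] at hz
      exact hz ▸ ha
    | succ n ih =>
      intro z hz
      obtain ⟨x, hx, hxz⟩ := G.exists_adj_of_dist_eq_succ hz
      by_contra hzM
      exact hc x (ih x hx) z hzM hxz
  exact hb (key _ b rfl)

theorem ball_subset_cball (x : V) (R : ℝ) : G.ball x R ⊆ G.cball x ⌈R⌉₊ := fun y hy => by
  have h1 : (G.graph.dist x y : ℝ) < R := hy
  have h2 := Nat.le_ceil R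
  rw [mem_cball]
  exact_mod_cast (h1.le.trans h2)

variable [Infinite V]

variable {G} in
theorem P0.finite_cball (hp : G.P0) (x : V) (n : ℕ) : (G.cball x n).Finite := by
  induction n with
  | zero =>
    refine (Set.finite_singleton x).subset fun y hy => ?_
    have : G.graph.dist x y = 0 := Nat.le_zero.1 hy
    exact (G.connected.dist_eq_zero_iff.1 this).symm
  | succ n ih =>
    refine (ih.union (ih.biUnion fun y _ => hp.finite_neighborSet y)).subset fun y hy => ?_
    rcases Nat.le_succ_iff.1 (G.mem_cball.1 hy) with h | h
    · exact Or.inl h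
    · obtain ⟨z, hz, hzy⟩ := G.exists_adj_of_dist_eq_succ h
      exact Or.inr (Set.mem_biUnion (x := z) hz.le hzy)

variable {G} in
theorem P0.finite_ball (hp : G.P0) (x : V) (R : ℝ) : (G.ball x R).Finite :=
  (hp.finite_cball x _).subset (G.ball_subset_cball x R)

/-! ### The minimum principle and the Dirichlet problem on finite sets -/

variable {G} in
-- At a negative minimum over D, superharmonicity forces all neighbours to share the value. By
-- connectedness and infinitude of `V` some edge leaves the finite set of minimisers, and at its
-- inner end the average strictly exceeds the minimum.
theorem P0.nonneg_of_superharmonic (hp : G.P0) {D : Set V} (hD : D.Finite) {f : V → ℝ}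
    (hf : ∀ x ∈ D, G.avg f x ≤ f x)
    (hb : ∀ x ∈ D, ∀ y, G.graph.Adj x y → y ∉ D → 0 ≤ f y) : ∀ x ∈ D, 0 ≤ f x := by
  by_contra! hc
  obtain ⟨x₁, hx₁, hneg⟩ := hc
  obtain ⟨x₀, hx₀, hmin⟩ := Set.exists_min_image D f hD ⟨x₁, hx₁⟩
  have hm : f x₀ < 0 := (hmin x₁ hx₁).trans_lt hneg
  obtain ⟨x, ⟨hxD, hx⟩, y, hy, hxy⟩ := G.exists_adj_notMem_of_finite
    (M := {x ∈ D | f x = f x₀}) (hD.subset fun x hx => hx.1) ⟨x₀, hx₀, rfl⟩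
  have hge : ∀ z ∈ G.nbrs x, f x₀ ≤ f z := fun z hz => by
    by_cases hzD : z ∈ D
    · exact hmin z hzD
    · exact hm.le.trans (hb x hxD z (hp.mem_nbrs.1 hz) hzD)
  have hgt : f x₀ < f y := by
    by_cases hyD : y ∈ D
    · exact lt_of_le_of_ne (hmin y hyD) fun h => hy ⟨hyD, h.symm⟩
    · exact hm.trans_le (hb x hxD y hxy hyD)
  have h1 : G.avg (fun _ => f x₀) x < G.avg f x :=
    Finset.sum_lt_sum (fun z hz => mul_le_mul_of_nonneg_left (hge z hz) (G.p_nonneg x z))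
      ⟨y, hp.mem_nbrs.2 hxy, mul_lt_mul_of_pos_left hgt (G.p_pos hxy)⟩
  rw [hp.avg_const] at h1
  have := hf x hxD
  rw [hx] at this
  linarith

variable {G} in
theorem P0.le_of_superharmonic (hp : G.P0) {D : Set V} (hD : D.Finite) {f g : V → ℝ}
    (hfg : ∀ x ∈ D, f x - G.avg f x ≤ g x - G.avg g x)
    (hb : ∀ x ∉ D, f x ≤ g x) (x : V) : f x ≤ g x := by
  by_cases hx : x ∈ D
  · have := hp.nonneg_of_superharmonic hD (f := fun x => g x - f x)
      (fun x hx => by rw [avg_sub]; linarith [hfg x hx])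
      (fun _ _ y _ hy => by linarith [hb y hy]) x hx
    linarith
  · exact hb x hx

open Classical in
variable {G} in
-- For zero boundary values the equation is a linear system on ℝ^D, injective by the comparison
-- principle and hence surjective.
theorem P0.exists_dirichlet (hp : G.P0) {D : Set V} (hD : D.Finite) (f φ : V → ℝ) :
    ∃ h : V → ℝ, (∀ x ∉ D, h x = f x) ∧ ∀ x ∈ D, h x - G.avg h x = φ x := by
  have := hD.fintype
  let ext : (D → ℝ) →ₗ[ℝ] (V → ℝ) :=
    { toFun := fun g y => if h : y ∈ D then g ⟨y, h⟩ else 0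
      map_add' := fun g g' => by
        ext y
        by_cases h : y ∈ D <;> simp [h]
      map_smul' := fun a g => by
        ext y
        by_cases h : y ∈ D <;> simp [h] }
  have ext_mem (g : D → ℝ) (x : D) : ext g x = g x := by simp [ext]
  have ext_notMem (g : D → ℝ) {x : V} (hx : x ∉ D) : ext g x = 0 := by simp [ext, hx]
  let T : (D → ℝ) →ₗ[ℝ] (D → ℝ) :=
    { toFun := fun g x => g x - G.avg (ext g) x
      map_add' := fun g g' => by
        ext x
        have : G.avg (ext (g + g')) x = G.avg (ext g) x + G.avg (ext g') x := by
          rw [map_add, ← avg_add]; rfl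
        simp only [Pi.add_apply, this]
        ring
      map_smul' := fun a g => by
        ext x
        have : G.avg (ext (a • g)) x = a * G.avg (ext g) x := by
          rw [map_smul, ← avg_smul]; rfl
        simp only [Pi.smul_apply, smul_eq_mul, this, RingHom.id_apply]
        ring }
  have hT : Function.Injective T := by
    rw [← LinearMap.ker_eq_bot, LinearMap.ker_eq_bot']
    intro g hg
    have h0 (x : V) (hx : x ∈ D) : ext g x - G.avg (ext g) x = 0 := by
      have := congrFun hg ⟨x, hx⟩
      rw [ext_mem g ⟨x, hx⟩]
      exact this
    ext x
    have h1 := hp.le_of_superharmonic hD (f := ext g) (g := fun _ => 0)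
      (fun y hy => by rw [h0 y hy, hp.avg_const]; simp) (fun y hy => (ext_notMem g hy).le) x
    have h2 := hp.le_of_superharmonic hD (f := fun _ => 0) (g := ext g)
      (fun y hy => by rw [h0 y hy, hp.avg_const]; simp) (fun y hy => (ext_notMem g hy).ge) x
    rw [ext_mem] at h1 h2
    exact le_antisymm h1 h2
  -- The boundary values, extended by 0 into D, are moved to the right-hand side.
  let b : V → ℝ := fun y => if y ∈ D then 0 else f y
  obtain ⟨g, hg⟩ := LinearMap.injective_iff_surjective.1 hT fun x => φ x + G.avg b x
  refine ⟨fun y => ext g y + b y, fun x hx => ?_, fun x hx => ?_⟩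
  · simp [ext_notMem g hx, b, hx]
  · have h1 : ext g x - G.avg (ext g) x = φ x + G.avg b x := by
      rw [ext_mem g ⟨x, hx⟩]
      exact congrFun hg ⟨x, hx⟩
    rw [avg_add]
    simp only [b, hx, if_true] at h1 ⊢
    linarith

/-! ### Mean exit times of finite sets -/

section MeanExit

variable [MeasurableSpace V] [DiscreteMeasurableSpace V]

theorem meanExit_of_notMem {A : Set V} {x : V} (hx : x ∉ A) : G.meanExit A x = 0 := by
  rw [meanExit_eq_tsum]
  simp [surv_succ_of_notMem _ hx]

variable {G} in
theorem P0.meanExit_of_mem (hp : G.P0) {A : Set V} {x : V} (hx : x ∈ A) :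
    G.meanExit A x = ∑ y ∈ G.nbrs x, G.step x y * (1 + G.meanExit A y) := by
  simp_rw [meanExit_eq_tsum, hp.surv_succ_of_mem hx]
  rw [Summable.tsum_finsetSum fun _ _ => ENNReal.summable]
  refine Finset.sum_congr rfl fun y _ => ?_
  rw [ENNReal.tsum_mul_left, tsum_eq_zero_add' ENNReal.summable, surv_zero]

theorem surv_mono {A B : Set V} (h : A ⊆ B) (n : ℕ) (x : V) : G.surv A n x ≤ G.surv B n x :=
  measure_mono fun _ hω i hi => h (hω i hi)

theorem meanExit_mono {A B : Set V} (h : A ⊆ B) (x : V) : G.meanExit A x ≤ G.meanExit B x := by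
  rw [meanExit_eq_tsum, meanExit_eq_tsum]
  exact ENNReal.tsum_le_tsum fun n => G.surv_mono h (n + 1) x

variable {G} in
theorem P0.surv_toReal_succ (hp : G.P0) {A : Set V} {x : V} (hx : x ∈ A) (n : ℕ) :
    (G.surv A (n + 1) x).toReal = G.avg (fun y => (G.surv A n y).toReal) x := by
  rw [hp.surv_succ_of_mem hx, ENNReal.toReal_sum]
  · simp [avg, p]
  · exact fun y _ => ENNReal.mul_ne_top (PMF.apply_ne_top _ _) (G.surv_ne_top A n y)

variable {G} in
-- The solution s of s − Ps = 1 on D, s = 0 off D, dominates every partial sum of the survival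
-- probabilities, by induction on the number of terms.
theorem P0.meanExit_ne_top (hp : G.P0) {D : Set V} (hD : D.Finite) (x : V) :
    G.meanExit D x ≠ ∞ := by
  obtain ⟨s, hs0, hs⟩ := hp.exists_dirichlet hD (fun _ => 0) (fun _ => 1)
  have key (N : ℕ) : ∀ x, ∑ n ∈ Finset.range N, (G.surv D (n + 1) x).toReal ≤ s x := by
    induction N with
    | zero =>
      intro x
      simpa using hp.le_of_superharmonic hD (f := fun _ => 0) (g := s)
        (fun y hy => by rw [hs y hy, hp.avg_const]; simp) (fun y hy => (hs0 y hy).ge) x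
    | succ N ih =>
      intro x
      by_cases hx : x ∈ D
      · have h1 : ∑ n ∈ Finset.range (N + 1), (G.surv D (n + 1) x).toReal =
            G.avg (fun y => ∑ n ∈ Finset.range (N + 1), (G.surv D n y).toReal) x := by
          simp_rw [hp.surv_toReal_succ hx]
          simp only [avg, Finset.mul_sum]
          exact Finset.sum_comm
        rw [h1]
        have h2 : G.avg (fun y => ∑ n ∈ Finset.range (N + 1), (G.surv D n y).toReal) x ≤
            G.avg (fun y => s y + 1) x := by
          refine G.avg_mono fun y _ => ?_
          rw [Finset.sum_range_succ', surv_zero, ENNReal.toReal_one]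
          linarith [ih y]
        rw [avg_add, hp.avg_const] at h2
        linarith [hs x hx]
      · simp [surv_succ_of_notMem _ hx, hs0 x hx]
  rw [meanExit_eq_tsum]
  refine ne_top_of_le_ne_top ENNReal.ofReal_ne_top (b := ENNReal.ofReal (s x)) ?_
  refine ENNReal.tsum_le_of_sum_range_le fun N => ?_
  rw [← ENNReal.ofReal_toReal (a := ∑ n ∈ Finset.range N, G.surv D (n + 1) x)
    (ENNReal.sum_ne_top.2 fun n _ => G.surv_ne_top D _ x),
    ENNReal.toReal_sum fun n _ => G.surv_ne_top D _ x]
  exact ENNReal.ofReal_le_ofReal (key N x)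

/-- The mean exit time as a real number. -/
def exitMean (D : Set V) (x : V) : ℝ := (G.meanExit D x).toReal

theorem exitMean_nonneg (D : Set V) (x : V) : 0 ≤ G.exitMean D x := ENNReal.toReal_nonneg

theorem exitMean_of_notMem {D : Set V} {x : V} (hx : x ∉ D) : G.exitMean D x = 0 := by
  simp [exitMean, meanExit_of_notMem _ hx]

variable {G} in
theorem P0.avg_exitMean (hp : G.P0) {D : Set V} (hD : D.Finite) {x : V} (hx : x ∈ D) :
    G.avg (G.exitMean D) x = G.exitMean D x - 1 := by
  have h : G.exitMean D x = G.avg (fun y => 1 + G.exitMean D y) x := by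
    rw [exitMean, hp.meanExit_of_mem hx, ENNReal.toReal_sum]
    · refine Finset.sum_congr rfl fun y _ => ?_
      rw [ENNReal.toReal_mul, ENNReal.toReal_add ENNReal.one_ne_top (hp.meanExit_ne_top hD y)]
      rfl
    · exact fun y _ => ENNReal.mul_ne_top (PMF.apply_ne_top _ _)
        (ENNReal.add_ne_top.2 ⟨ENNReal.one_ne_top, hp.meanExit_ne_top hD y⟩)
  rw [h, avg_add, hp.avg_const]
  ring

variable {G} in
theorem P0.one_le_exitMean (hp : G.P0) {D : Set V} (hD : D.Finite) {x : V} (hx : x ∈ D) :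
    1 ≤ G.exitMean D x := by
  have h1 := hp.avg_exitMean hD hx
  have h2 : 0 ≤ G.avg (G.exitMean D) x := G.avg_nonneg fun y _ => G.exitMean_nonneg D y
  linarith

end MeanExit

/-! ### Green functions -/

/-- `g` is the Green function with pole `a` of the walk killed outside `D`, divided by the vertex
measure of the pole. -/
structure IsGreen (D : Set V) (a : V) (g : V → ℝ) : Prop where
  eq_zero : ∀ x ∉ D, g x = 0
  pole : g a - G.avg g a = (G.mu a).toReal⁻¹
  harmonic : ∀ x ∈ D, x ≠ a → G.avg g x = g x

theorem mu_toReal_pos (x : V) : 0 < (G.mu x).toReal :=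
  ENNReal.toReal_pos (G.mu_ne_zero x) (G.tsum_weight_ne_top x)

theorem mu_mul_p (x y : V) : (G.mu x).toReal * G.p x y = (G.weight x y : ℝ) := by
  rw [p, step_apply, ENNReal.toReal_div, mul_div_cancel₀ _ (G.mu_toReal_pos x).ne']
  rfl

variable {G}

theorem P0.exists_isGreen (hp : G.P0) {D : Set V} (hD : D.Finite) {a : V} (ha : a ∈ D) :
    ∃ g, G.IsGreen D a g := by
  classical
  obtain ⟨g, hg0, hg⟩ := hp.exists_dirichlet hD (fun _ => 0)
    (fun x => if x = a then (G.mu a).toReal⁻¹ else 0)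
  refine ⟨g, hg0, by simpa using hg a ha, fun x hx hxa => ?_⟩
  have := hg x hx
  rw [if_neg hxa] at this
  linarith

theorem IsGreen.avg_le {D : Set V} {a : V} {g : V → ℝ} (hg : G.IsGreen D a g) {x : V}
    (hx : x ∈ D) : G.avg g x ≤ g x := by
  by_cases hxa : x = a
  · have := hg.pole
    have h2 := inv_pos.2 (G.mu_toReal_pos a)
    rw [hxa]
    linarith
  · exact (hg.harmonic x hx hxa).le

theorem IsGreen.nonneg (hp : G.P0) {D : Set V} (hD : D.Finite) {a : V} {g : V → ℝ}
    (hg : G.IsGreen D a g) (x : V) : 0 ≤ g x :=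
  hp.le_of_superharmonic hD (f := fun _ => 0)
    (fun y hy => by rw [hp.avg_const]; linarith [hg.avg_le hy]) (fun y hy => (hg.eq_zero y hy).ge) x

theorem IsGreen.pos (hp : G.P0) {D : Set V} (hD : D.Finite) {a : V} {g : V → ℝ}
    (hg : G.IsGreen D a g) {n : ℕ} (hn : G.cball a n ⊆ D) {x : V} (hx : x ∈ G.cball a n) :
    0 < g x := by
  have key : ∀ i : ℕ, ∀ x, G.graph.dist a x = i → i ≤ n → 0 < g x := by
    intro i
    induction i with
    | zero =>
      intro x hx _
      rw [G.connected.dist_eq_zero_iff] at hx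
      subst hx
      have h1 := hg.pole
      have h2 := inv_pos.2 (G.mu_toReal_pos a)
      have h3 : 0 ≤ G.avg g a := G.avg_nonneg fun y _ => hg.nonneg hp hD y
      linarith
    | succ i ih =>
      intro x hx hi
      obtain ⟨y, hy, hyx⟩ := G.exists_adj_of_dist_eq_succ hx
      refine lt_of_lt_of_le ?_ (hg.avg_le (x := x) (hn (by rw [mem_cball]; lia)))
      exact Finset.sum_pos' (fun z _ => mul_nonneg (G.p_nonneg x z) (hg.nonneg hp hD z))
        ⟨y, hp.mem_nbrs.2 hyx.symm, mul_pos (G.p_pos hyx.symm) (ih y hy (by lia))⟩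
  exact key _ x rfl hx

theorem P0.sum_mu_mul_avg (hp : G.P0) {D : Finset V} {f g : V → ℝ} (hg : ∀ x ∉ D, g x = 0) :
    ∑ x ∈ D, (G.mu x).toReal * f x * G.avg g x =
      ∑ x ∈ D, ∑ y ∈ D, (G.weight x y : ℝ) * f x * g y := by
  classical
  refine Finset.sum_congr rfl fun x _ => ?_
  have h1 : G.avg g x = ∑ y ∈ D, G.p x y * g y := by
    rw [avg, ← Finset.sum_subset (Finset.inter_subset_left (s₂ := D)),
      Finset.sum_subset (Finset.inter_subset_right (s₁ := G.nbrs x))]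
    · intro y hy hy'
      have : ¬ G.graph.Adj x y := fun h => hy' (Finset.mem_inter.2 ⟨hp.mem_nbrs.2 h, hy⟩)
      rw [G.p_eq_zero this, zero_mul]
    · intro y hy hy'
      rw [hg y fun h => hy' (Finset.mem_inter.2 ⟨hy, h⟩), mul_zero]
  rw [h1, Finset.mul_sum]
  refine Finset.sum_congr rfl fun y _ => ?_
  rw [← mu_mul_p]
  ring

theorem IsGreen.sum_eq {D : Finset V} {a : V} {g : V → ℝ} (hg : G.IsGreen D a g) (ha : a ∈ D)
    (f : V → ℝ) : ∑ x ∈ D, (G.mu x).toReal * f x * (g x - G.avg g x) = f a := by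
  rw [Finset.sum_eq_single a]
  · rw [hg.pole]
    field_simp [(G.mu_toReal_pos a).ne']
  · intro x hx hxa
    rw [hg.harmonic x hx hxa, sub_self, mul_zero]
  · exact fun h => absurd ha h

/-- Green's second identity: the form ∑ μ(x) f(x) (g − Pg)(x) is symmetric because the weights are,
and each pole condition evaluates it at one point. -/
theorem IsGreen.symm (hp : G.P0) {D : Set V} (hD : D.Finite) {a b : V} {g h : V → ℝ} (ha : a ∈ D)
    (hb : b ∈ D) (hg : G.IsGreen D a g) (hh : G.IsGreen D b h) : g b = h a := by
  lift D to Finset V using hD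
  rw [← hh.sum_eq hb g, ← hg.sum_eq ha h]
  simp_rw [mul_sub]
  rw [Finset.sum_sub_distrib, Finset.sum_sub_distrib, hp.sum_mu_mul_avg hh.eq_zero,
    hp.sum_mu_mul_avg hg.eq_zero]
  congr 1
  · exact Finset.sum_congr rfl fun x _ => by ring
  · rw [Finset.sum_comm]
    refine Finset.sum_congr rfl fun x _ => Finset.sum_congr rfl fun y _ => ?_
    rw [G.weight_symm y x]
    ring

end

/-! ### Upper bound: a discounted exit estimate iterated over stages. -/

section

variable {V : Type*} {G : WeightedGraph V}

/-! ### The upper bound -/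

variable [Infinite V] [MeasurableSpace V] [DiscreteMeasurableSpace V]

/-- Each stage is the exit from a ball of radius r about the current position. It uses up distance
⌈r⌉ and gains the factor 1 − 1/(2C), while s^{-n} pays for discounting the time by s per step. -/
theorem P0.exitProb_le_of_stages (hp : G.P0) {C : ℝ} (hC : 1 ≤ C) {x : V} {R r s : ℝ} (hr : 0 < r)
    (hs : 0 < s) (hs1 : s ≤ 1)
    (hE : ∀ z ∈ G.ball x R, (∀ y, G.exitMean (G.ball z r) y ≤ C * G.exitMean (G.ball z r) z) ∧
      s ≤ (1 - s) * (C * G.exitMean (G.ball z r) z))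
    {j : ℕ} (hj : (j : ℝ) * ⌈r⌉₊ ≤ R) (n : ℕ) :
    G.exitProb (G.ball x R) n x ≤ s⁻¹ ^ n * (1 - 1 / (2 * C)) ^ j := by
  have hθ : 0 ≤ 1 - 1 / (2 * C) := by
    rw [sub_nonneg, div_le_one (by linarith)]
    linarith
  have hs1' : 1 ≤ s⁻¹ := (one_le_inv₀ hs).2 hs1
  have hr1 : 1 ≤ ⌈r⌉₊ := Nat.one_le_ceil_iff.2 hr
  -- Here i counts the stages still ahead. The time n must stay free, since a stage may end at any
  -- time.
  suffices key : ∀ i ≤ j, ∀ w, G.graph.dist x w ≤ (j - i) * ⌈r⌉₊ → ∀ n,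
      G.exitProb (G.ball x R) n w ≤ s⁻¹ ^ n * (1 - 1 / (2 * C)) ^ i from
    key j le_rfl x (by simp) n
  intro i
  induction i with
  | zero =>
    intro _ w _ n
    rw [pow_zero, mul_one]
    exact (G.exitProb_le_one _ n w).trans (one_le_pow₀ hs1')
  | succ i ih =>
    intro hi w₀ hw₀ n
    obtain ⟨t, rfl⟩ : ∃ t, j = i + 1 + t := ⟨j - (i + 1), by lia⟩
    have e1 : i + 1 + t - (i + 1) = t := by lia
    have e2 : i + 1 + t - i = t + 1 := by lia
    rw [e1] at hw₀
    rw [e2] at ih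
    have hjR : (i + 1 + t) * ⌈r⌉₊ ≤ R := by exact_mod_cast hj
    have hball {w : V} (hw : G.graph.dist x w < (t + 1) * ⌈r⌉₊) : w ∈ G.ball x R := by
      have h1 : (G.graph.dist x w : ℝ) < (t + 1) * ⌈r⌉₊ := by exact_mod_cast hw
      have h2 : (0 : ℝ) ≤ i * ⌈r⌉₊ := by positivity
      change (G.graph.dist x w : ℝ) < R
      nlinarith
    set D := G.ball w₀ r with hDdef
    have hD : D.Finite := hp.finite_ball w₀ r
    obtain ⟨hE1, hE2⟩ := hE w₀ (hball (by nlinarith))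
    have hw₀D : w₀ ∈ D := by simpa [hDdef, ball] using hr
    have hEpos : 1 ≤ G.exitMean D w₀ := hp.one_le_exitMean hD hw₀D
    set a : ℝ := 1 / (2 * (C * G.exitMean D w₀)) with ha
    have hCE : 0 < C * G.exitMean D w₀ := by positivity
    have ha0 : 0 < a := by positivity
    have haE : a * (C * G.exitMean D w₀) = 1 / 2 := by rw [ha]; field_simp
    have hψ (w : V) : 1 / 2 ≤ 1 - a * G.exitMean D w := by
      have := mul_le_mul_of_nonneg_left (hE1 w) ha0.le
      linarith
    have hsa : s * a ≤ (1 - s) * (1 / 2) := by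
      have := mul_le_mul_of_nonneg_right hE2 ha0.le
      linarith [mul_assoc (1 - s) (C * G.exitMean D w₀) a, mul_comm (C * G.exitMean D w₀) a,
        congrArg (fun t => (1 - s) * t) haE]
    -- With ψ = 1 − a·E_·(D) one has Pψ = ψ + a in D, so this says sPψ ≤ ψ there.
    have hstep (w : V) : s * (1 - a * G.exitMean D w + a) ≤ 1 - a * G.exitMean D w := by
      nlinarith [hψ w]
    -- The closed ball of radius ⌈r⌉ contains D and all its neighbours, so one step from D stays in
    -- range. Off D, ψ = 1 and the hypothesis with one stage fewer applies.
    suffices hin : ∀ n, ∀ w, G.graph.dist w₀ w ≤ ⌈r⌉₊ →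
        G.exitProb (G.ball x R) n w ≤
          s⁻¹ ^ n * (1 - 1 / (2 * C)) ^ i * (1 - a * G.exitMean D w) by
      have h1 := hin n w₀ (by simp)
      have h2 : 1 - a * G.exitMean D w₀ = 1 - 1 / (2 * C) := by rw [ha]; field_simp
      rw [h2] at h1
      rw [pow_succ, ← mul_assoc]
      exact h1
    have hout {w : V} (hw : G.graph.dist w₀ w ≤ ⌈r⌉₊) (hwD : w ∉ D) (n : ℕ) :
        G.exitProb (G.ball x R) n w ≤
          s⁻¹ ^ n * (1 - 1 / (2 * C)) ^ i * (1 - a * G.exitMean D w) := by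
      rw [G.exitMean_of_notMem hwD, mul_zero, sub_zero, mul_one]
      refine ih (by lia) w ?_ n
      have := G.dist_triangle x w₀ w
      nlinarith
    intro n
    induction n with
    | zero =>
      intro w _
      rw [exitProb_zero]
      have := hψ w
      positivity
    | succ n ihn =>
      intro w hw
      by_cases hwD : w ∈ D
      · have hlt : G.graph.dist w₀ w < ⌈r⌉₊ := Nat.lt_ceil.2 hwD
        have hwR : w ∈ G.ball x R := by
          refine hball ?_
          have := G.dist_triangle x w₀ w
          nlinarith
        rw [hp.exitProb_succ_of_mem hwR]
        calc G.avg (G.exitProb (G.ball x R) n) w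
            ≤ G.avg (fun y => s⁻¹ ^ n * (1 - 1 / (2 * C)) ^ i * (1 - a * G.exitMean D y)) w := by
              refine G.avg_mono fun y hy => ihn y ?_
              have := G.dist_le_succ_of_adj (x := w₀) (hp.mem_nbrs.1 hy)
              lia
          _ = s⁻¹ ^ n * (1 - 1 / (2 * C)) ^ i * (1 - a * G.exitMean D w + a) := by
              rw [avg_smul, avg_sub, avg_smul, hp.avg_const, hp.avg_exitMean hD hwD]
              ring
          _ ≤ s⁻¹ ^ n * (1 - 1 / (2 * C)) ^ i * (s⁻¹ * (1 - a * G.exitMean D w)) := by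
              refine mul_le_mul_of_nonneg_left ?_ (by positivity)
              rw [inv_mul_eq_div, le_div_iff₀ hs]
              linarith [hstep w]
          _ = _ := by ring
      · exact hout hw hwD _

theorem EbarCondition.exitMean_le (hp : G.P0) {C : ℝ≥0} {z : V} {r : ℝ}
    (h : G.Ebar z r ≤ C * G.E z r) (y : V) :
    G.exitMean (G.ball z r) y ≤ C * G.exitMean (G.ball z r) z := by
  by_cases hy : y ∈ G.ball z r
  · have h1 : G.meanExit (G.ball z r) y ≤ C * G.meanExit (G.ball z r) z :=
      (le_iSup₂ (f := fun y _ => G.meanExit (G.ball z r) y) y hy).trans h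
    have h2 := ENNReal.toReal_mono
      (ENNReal.mul_ne_top ENNReal.coe_ne_top (hp.meanExit_ne_top (hp.finite_ball z r) z)) h1
    rwa [ENNReal.toReal_mul] at h2
  · rw [exitMean_of_notMem _ hy]
    exact mul_nonneg C.2 (G.exitMean_nonneg _ _)

/-- A value other than 1 cannot come from the default, so the supremum is attained by an admissible
integer. -/
theorem k_spec (q : ℝ≥0) (x : V) (n : ℕ) (R : ℝ) (h : G.k q x n R ≠ 1) :
    2 ≤ G.k q x n R ∧ (G.k q x n R : ℝ) ≤ R ∧ ∀ z ∈ G.ball x R,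
      (n : ℝ≥0∞) / G.k q x n R ≤ q * G.E z (R / G.k q x n R) := by
  set S : Set ℕ := {k : ℕ | 1 ≤ k ∧ (k : ℝ) ≤ R ∧
    (n : ℝ≥0∞) / k ≤ q * ⨅ z ∈ G.ball x R, G.E z (R / k)} with hS
  have hk : G.k q x n R = max 1 (sSup S) := rfl
  have h2 : 2 ≤ sSup S := by
    rw [hk] at h
    lia
  have hk' : G.k q x n R = sSup S := by rw [hk]; lia
  have hne : S.Nonempty := by
    by_contra hc
    rw [Set.not_nonempty_iff_eq_empty.1 hc] at h2
    simp at h2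
  have hbdd : BddAbove S := ⟨⌊R⌋₊, fun k hk => Nat.le_floor hk.2.1⟩
  have hmem := Nat.sSup_mem hne hbdd
  rw [hk']
  exact ⟨h2, hmem.2.1, fun z hz => hmem.2.2.trans (by gcongr; exact iInf₂_le z hz)⟩

theorem EbarCondition.exitProb_le (hp : G.P0) (hE : G.EbarCondition) :
    ∃ q : ℝ≥0, 0 < q ∧ ∃ c : ℝ, 0 < c ∧ ∃ C : ℝ, 0 < C ∧
      ∀ (x : V) (R : ℝ) (n : ℕ), 0 < R → R ≤ n →
        G.exitProb (G.ball x R) n x ≤ C * Real.exp (-c * G.k q x n R) := by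
  obtain ⟨C₁, -, hC₁⟩ := hE
  set C₀ : ℝ≥0 := max C₁ 1 with hC₀
  have hC1 : (1 : ℝ) ≤ C₀ := by exact_mod_cast le_max_right C₁ 1
  set θ : ℝ := 1 - 1 / (2 * C₀) with hθ
  have hθ0 : 0 < θ := by
    rw [hθ, sub_pos, div_lt_one (by linarith)]
    linarith
  have hθ1 : θ < 1 := by
    have : (0 : ℝ) < 1 / (2 * C₀) := by positivity
    linarith
  -- Thus θ = exp(−4δ). At least (k − 1)/2 stages gain exp(−2δ(k − 1)) and discounting costs
  -- exp(δk), leaving exp(−δk + 2δ).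
  set δ : ℝ := -Real.log θ / 4 with hδdef
  have hδ : 0 < δ := by
    have := Real.log_neg hθ0 hθ1
    rw [hδdef]
    linarith
  have hθδ : θ = Real.exp (-(4 * δ)) := by
    rw [hδdef, show -(4 * (-Real.log θ / 4)) = Real.log θ by ring, Real.exp_log hθ0]
  refine ⟨C₀ * ⟨δ, hδ.le⟩, mul_pos (lt_of_lt_of_le one_pos (le_max_right _ _)) hδ, δ, hδ,
    Real.exp (2 * δ), Real.exp_pos _, ?_⟩
  intro x R n hR hRn
  set q : ℝ≥0 := C₀ * ⟨δ, hδ.le⟩ with hq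
  have hqr : (q : ℝ) = C₀ * δ := rfl
  set k := G.k q x n R with hk
  rw [← Real.exp_add]
  -- For k = 1, default or not, the bound is exp(2δ − δ) ≥ 1 and says nothing.
  by_cases hk1 : k = 1
  · refine (G.exitProb_le_one _ n x).trans (Real.one_le_exp ?_)
    rw [hk1]
    push_cast
    linarith
  obtain ⟨hk2, hkR, hkE⟩ := k_spec q x n R hk1
  rw [← hk] at hk2 hkR hkE
  have hn : (0 : ℝ) < n := hR.trans_le hRn
  have hk0 : (0 : ℝ) < k := by exact_mod_cast (show 0 < k by lia)
  -- This makes n·lam = δk, and the inequality defining k with q = C₀δ becomes 1 ≤ lam·C₀·E(z,R/k).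
  set lam : ℝ := δ * k / n with hlam
  have hlam0 : 0 < lam := by positivity
  have hstages := hp.exitProb_le_of_stages hC1 (x := x) (R := R) (r := R / k) (s := Real.exp (-lam))
    (by positivity) (Real.exp_pos _) (Real.exp_le_one_iff.2 (by linarith)) (fun z hz => ⟨?_, ?_⟩)
    (j := k / 2) ?_ n
  · refine hstages.trans ?_
    rw [← hθ, hθδ, ← Real.exp_neg, neg_neg, ← Real.exp_nat_mul, ← Real.exp_nat_mul, ← Real.exp_add]
    refine Real.exp_le_exp.2 ?_
    have h1 : (n : ℝ) * lam = δ * k := by rw [hlam]; field_simp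
    have h2 : (k : ℝ) ≤ 2 * ((k / 2 : ℕ) : ℝ) + 1 := by exact_mod_cast (show k ≤ 2 * (k / 2) + 1 by lia)
    rw [h1]
    nlinarith
  · refine EbarCondition.exitMean_le hp ((hC₁ z (R / k) (by positivity)).trans ?_)
    gcongr
    exact le_max_left _ _
  · have h1 := hkE z hz
    have h2 := ENNReal.toReal_mono (ENNReal.mul_ne_top ENNReal.coe_ne_top
      (hp.meanExit_ne_top (hp.finite_ball z (R / k)) z)) h1
    rw [ENNReal.toReal_div, ENNReal.toReal_mul, ENNReal.coe_toReal, hqr] at h2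
    simp only [ENNReal.toReal_natCast] at h2
    change (n : ℝ) / k ≤ C₀ * δ * G.exitMean (G.ball z (R / k)) z at h2
    rw [div_le_iff₀ hk0] at h2
    have h3 : 1 ≤ lam * (C₀ * G.exitMean (G.ball z (R / k)) z) := by
      rw [hlam, div_mul_eq_mul_div, le_div_iff₀ hn]
      linarith
    have h4 : Real.exp (-lam) * lam ≤ 1 - Real.exp (-lam) := by
      have h5 := Real.add_one_le_exp lam
      have h6 : Real.exp (-lam) * Real.exp lam = 1 := by rw [← Real.exp_add]; simp
      nlinarith [Real.exp_pos (-lam)]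
    have h7 : 0 ≤ C₀ * G.exitMean (G.ball z (R / k)) z := mul_nonneg C₀.2 (G.exitMean_nonneg _ _)
    calc Real.exp (-lam) ≤ Real.exp (-lam) * (lam * (C₀ * G.exitMean (G.ball z (R / k)) z)) :=
          le_mul_of_one_le_right (Real.exp_pos _).le h3
      _ = Real.exp (-lam) * lam * (C₀ * G.exitMean (G.ball z (R / k)) z) := by ring
      _ ≤ _ := mul_le_mul_of_nonneg_right h4 h7
  -- Rounding R/k up at most doubles it, as k ≤ R; this is why only k/2 stages are used.
  · have h1 : (⌈R / k⌉₊ : ℝ) ≤ R / k + 1 := (Nat.ceil_lt_add_one (by positivity)).le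
    have h2 : ((k / 2 : ℕ) : ℝ) ≤ k / 2 := Nat.cast_div_le
    calc ((k / 2 : ℕ) : ℝ) * ⌈R / k⌉₊ ≤ k / 2 * (R / k + 1) := by gcongr
      _ = (R + k) / 2 := by field_simp
      _ ≤ R := by linarith

end

/-! ### Hitting probabilities of balls from the Harnack inequality. -/

section

variable {V : Type*} {G : WeightedGraph V}

/-! ### The Harnack inequality on closed balls and along geodesics -/

section Harnack

variable [Infinite V]

variable (G) in
/-- The elliptic Harnack inequality with constant `C` for closed balls of integer radius and
globally non-negative functions. -/
def HarnackWith (C : ℝ) : Prop :=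
  ∀ (x : V) (k : ℕ) (u : V → ℝ), (∀ y, 0 ≤ u y) → (∀ y ∈ G.cball x (2 * k), G.avg u y = u y) →
    ∀ y ∈ G.cball x k, ∀ z ∈ G.cball x k, u y ≤ C * u z

theorem EllipticHarnack.harnackWith (hp : G.P0) (h : G.EllipticHarnack) :
    ∃ C, 1 ≤ C ∧ G.HarnackWith C := by
  obtain ⟨C, -, hC⟩ := h
  refine ⟨max C 1, le_max_right _ _, fun x k u hu hharm y hy z hz => ?_⟩
  -- The open balls of radii k + 1/2 and 2k + 1 are the closed balls of radii k and 2k, and k = 0 is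
  -- allowed.
  have hsub {w : V} (hw : w ∈ G.cball x k) : w ∈ G.ball x (k + 1 / 2) := by
    have : (G.graph.dist x w : ℝ) ≤ k := by exact_mod_cast hw
    change (G.graph.dist x w : ℝ) < k + 1 / 2
    linarith
  refine (hC x (k + 1 / 2) (by positivity) u (fun y _ => hu y) (fun w hw => ?_) y (hsub hy) z
    (hsub hz)).trans (mul_le_mul_of_nonneg_right (le_max_left _ _) (hu z))
  have hw' : (G.graph.dist x w : ℝ) < 2 * (k + 1 / 2) := hw
  have : G.graph.dist x w < 2 * k + 1 := by
    have : (G.graph.dist x w : ℝ) < 2 * k + 1 := by linarith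
    exact_mod_cast this
  have h1 := hp.hasSum_avg u w
  rwa [hharm w (Nat.lt_succ_iff.1 this)] at h1

/-- Chaining: each piece of length at most k costs one factor C. -/
theorem HarnackWith.le_along_geodesic {C : ℝ} (hH : G.HarnackWith C) (hC : 1 ≤ C) {u : V → ℝ}
    (hu : ∀ y, 0 ≤ u y) {k N : ℕ} {a b : V} (hab : G.graph.dist a b ≤ N * k)
    (hharm : ∀ x, G.graph.dist a x + G.graph.dist x b = G.graph.dist a b →
      ∀ y ∈ G.cball x (2 * k), G.avg u y = u y) : u a ≤ C ^ N * u b := by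
  induction N generalizing a with
  | zero =>
    rw [zero_mul, Nat.le_zero, G.connected.dist_eq_zero_iff] at hab
    simp [hab]
  | succ N ih =>
    obtain ⟨x, hx, hxb⟩ := G.exists_between (a := a) (b := b) (j := min k (G.graph.dist a b))
      (min_le_right _ _)
    have h1 : u a ≤ C * u x := hH a k u hu (hharm a (by simp)) a (by simp [mem_cball]) x
      (hx.le.trans (min_le_left _ _))
    have h2 : u x ≤ C ^ N * u b := by
      refine ih (by rw [Nat.succ_mul] at hab; lia) fun w hw => hharm w ?_
      have := G.dist_triangle a x w
      have := G.dist_triangle a w b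
      lia
    calc u a ≤ C * u x := h1
      _ ≤ C * (C ^ N * u b) := by gcongr
      _ = C ^ (N + 1) * u b := by ring

/-! ### Green functions and hitting probabilities under the Harnack inequality -/

theorem HarnackWith.isGreen_le (hp : G.P0) {C : ℝ} (hH : G.HarnackWith C) (hC : 1 ≤ C) {D : Set V}
    (hD : D.Finite) {a : V} {g : V → ℝ} (hg : G.IsGreen D a g) {k N : ℕ} {b c : V}
    (hbc : G.graph.dist b c ≤ N * k)
    (hgeo : ∀ x, G.graph.dist b x + G.graph.dist x c = G.graph.dist b c →
      2 * k < G.graph.dist a x ∧ G.cball x (2 * k) ⊆ D) : g b ≤ C ^ N * g c := by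
  refine hH.le_along_geodesic hC (hg.nonneg hp hD) hbc fun x hx y hy => ?_
  obtain ⟨h1, h2⟩ := hgeo x hx
  refine hg.harmonic y (h2 hy) ?_
  rintro rfl
  rw [mem_cball, SimpleGraph.dist_comm] at hy
  lia

/-- If a and b are close, a geodesic between them avoids the pole z. If they are far apart, it might
pass near z, so the pole is moved instead: g_z(a) = g_a(z) is compared with g_a(b) along a geodesic
avoiding a, then g_b(a) with g_b(z) along one avoiding b. -/
theorem HarnackWith.isGreen_le_of_dist_eq (hp : G.P0) {C : ℝ} (hH : G.HarnackWith C) (hC : 1 ≤ C)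
    {D : Set V} (hD : D.Finite) {k : ℕ} (hk : 1 ≤ k) {z a b : V} (hzD : G.cball z (50 * k) ⊆ D)
    {g : V → ℝ} (hg : G.IsGreen D z g) (ha : G.graph.dist z a = 12 * k)
    (hb : G.graph.dist z b = 12 * k) : g a ≤ C ^ 24 * g b := by
  have hsub {x : V} (hx : G.graph.dist z x ≤ 48 * k) : G.cball x (2 * k) ⊆ D := fun y hy => by
    refine hzD ?_
    have := G.dist_triangle z x y
    rw [mem_cball] at hy ⊢
    lia
  rcases le_total (G.graph.dist a b) (6 * k) with hab | hab
  · refine (hH.isGreen_le hp hC hD hg hab fun x hx => ?_).trans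
      (mul_le_mul_of_nonneg_right (pow_le_pow_right₀ hC (by norm_num)) (hg.nonneg hp hD b))
    have h1 := G.dist_triangle z x a
    have h2 := G.dist_triangle z x b
    have h3 := G.dist_triangle z a x
    rw [G.graph.dist_comm (u := x) (v := a)] at h1
    exact ⟨by lia, hsub (by lia)⟩
  · have haD : a ∈ D := hzD (by rw [mem_cball]; lia)
    have hbD : b ∈ D := hzD (by rw [mem_cball]; lia)
    have hzz : z ∈ D := hzD (by simp [mem_cball])
    obtain ⟨ga, hga⟩ := hp.exists_isGreen hD haD
    obtain ⟨gb, hgb⟩ := hp.exists_isGreen hD hbD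
    have h1 : ga z ≤ C ^ 12 * ga b := by
      refine hH.isGreen_le hp hC hD hga hb.le fun x hx => ?_
      have h1 := G.dist_triangle z x a
      have h2 := G.dist_triangle a x b
      rw [G.graph.dist_comm (u := x) (v := a)] at h1
      exact ⟨by lia, hsub (by lia)⟩
    have h2 : gb a ≤ C ^ 12 * gb z := by
      refine hH.isGreen_le hp hC hD hgb (by rw [SimpleGraph.dist_comm]; exact ha.le) fun x hx => ?_
      have h1 := G.dist_triangle b x a
      have h2 := G.dist_triangle z x b
      rw [G.graph.dist_comm (u := x) (v := b)] at h2
      rw [G.graph.dist_comm (u := x) (v := a), G.graph.dist_comm (u := b) (v := a)] at h1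
      rw [G.graph.dist_comm (u := a) (v := z), G.graph.dist_comm (u := x) (v := z)] at hx
      exact ⟨by lia, hsub (by lia)⟩
    rw [hg.symm hp hD hzz haD hga, hg.symm hp hD hzz hbD hgb]
    rw [hga.symm hp hD haD hbD hgb] at h1
    calc ga z ≤ C ^ 12 * gb a := h1
      _ ≤ C ^ 12 * (C ^ 12 * gb z) := by gcongr
      _ = C ^ 24 * gb z := by ring

theorem HarnackWith.isGreen_le_of_dist_le (hp : G.P0) {C : ℝ} (hH : G.HarnackWith C) (hC : 1 ≤ C)
    {D : Set V} (hD : D.Finite) {k : ℕ} (hk : 1 ≤ k) {z a w : V} (hzD : G.cball z (50 * k) ⊆ D)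
    {g : V → ℝ} (hg : G.IsGreen D z g) (ha : G.graph.dist z a = 12 * k)
    (hw : 12 * k ≤ G.graph.dist z w) (hw' : G.graph.dist z w ≤ 48 * k) : g a ≤ C ^ 60 * g w := by
  obtain ⟨b, hb, hbw⟩ := G.exists_between hw
  have h1 := hH.isGreen_le_of_dist_eq hp hC hD hk hzD hg ha hb
  have h2 : g b ≤ C ^ 36 * g w := by
    refine hH.isGreen_le hp hC hD hg (k := k) (by lia) fun x hx => ?_
    have h3 := G.dist_triangle z x w
    have h4 := G.dist_triangle z b x
    refine ⟨by lia, fun y hy => hzD ?_⟩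
    have := G.dist_triangle z x y
    rw [mem_cball] at hy ⊢
    lia
  calc g a ≤ C ^ 24 * g b := h1
    _ ≤ C ^ 24 * (C ^ 36 * g w) := by gcongr
    _ = C ^ 60 * g w := by ring

theorem HarnackWith.le_hitting (hp : G.P0) {C : ℝ} (hH : G.HarnackWith C) (hC : 1 ≤ C)
    {D : Set V} (hD : D.Finite) {k : ℕ} (hk : 1 ≤ k) {z w : V} (hzD : G.cball z (50 * k) ⊆ D)
    {u : V → ℝ} (hu1 : ∀ x ∈ G.cball z (12 * k), u x = 1) (hu0 : ∀ x ∉ D, u x = 0)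
    (hharm : ∀ x ∈ D, x ∉ G.cball z (12 * k) → G.avg u x = u x)
    (hw : G.graph.dist z w ≤ 48 * k) : (C ^ 60)⁻¹ ≤ u w := by
  have hC60 : 1 ≤ C ^ 60 := one_le_pow₀ hC
  by_cases hwB : w ∈ G.cball z (12 * k)
  · rw [hu1 w hwB]
    exact inv_le_one_of_one_le₀ hC60
  have hwB' : 12 * k < G.graph.dist z w := not_le.1 hwB
  have hzz : z ∈ D := hzD (by simp [mem_cball])
  obtain ⟨g, hg⟩ := hp.exists_isGreen hD hzz
  obtain ⟨b, hb, -⟩ := G.exists_between hwB'.le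
  obtain ⟨a, ha, hmax⟩ := Set.exists_max_image {x | G.graph.dist z x = 12 * k} g
    ((hp.finite_cball z (12 * k)).subset fun x hx => le_of_eq hx) ⟨b, hb⟩
  have hga : 0 < g a := hg.pos hp hD hzD (x := a) (by
    have : G.graph.dist z a = 12 * k := ha
    rw [mem_cball]
    lia)
  have hle := hH.isGreen_le_of_dist_le hp hC hD hk hzD hg ha hwB'.le hw
  have hwD : w ∈ D := hzD (by rw [mem_cball]; lia)
  -- With a maximising g on the sphere of radius 12k, g(a)·u dominates g on the boundary of the
  -- annular region, hence inside it. So u(w) ≥ g(w)/g(a).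
  have hcmp := hp.nonneg_of_superharmonic (D := D \ G.cball z (12 * k)) (hD.subset Set.sdiff_subset)
    (f := fun x => g a * u x - g x) (fun x hx => by
      have hxz : x ≠ z := by
        rintro rfl
        exact hx.2 (by simp [mem_cball])
      rw [avg_sub, avg_smul, hharm x hx.1 hx.2, hg.harmonic x hx.1 hxz])
    (fun x hx y hxy hy => by
      by_cases hyD : y ∈ D
      · have hyB : y ∈ G.cball z (12 * k) := by
          by_contra h
          exact hy ⟨hyD, h⟩
        have h1 : ¬ G.graph.dist z x ≤ 12 * k := hx.2
        have h2 := G.dist_le_succ_of_adj (x := z) hxy.symm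
        have h3 : G.graph.dist z y = 12 * k := by
          rw [mem_cball] at hyB
          lia
        have := hmax y h3
        rw [hu1 y hyB]
        linarith
      · simp [hu0 y hyD, hg.eq_zero y hyD]) w ⟨hwD, hwB⟩
  rw [inv_le_iff_one_le_mul₀ (by positivity)]
  have h4 : g a ≤ C ^ 60 * (g a * u w) := hle.trans (by
    refine mul_le_mul_of_nonneg_left ?_ (by positivity)
    linarith)
  have h5 : g a * 1 ≤ g a * (u w * C ^ 60) := by linarith
  exact le_of_mul_le_mul_left h5 hga

/-- For every finite `D` there is a function with the properties of the probability of hitting `B`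
before leaving `D`. -/
theorem P0.exists_hitting (hp : G.P0) {B D : Set V} (hD : D.Finite) (hBD : B ⊆ D) :
    ∃ u : V → ℝ, (∀ x ∈ B, u x = 1) ∧ (∀ x ∉ D, u x = 0) ∧
      (∀ x ∈ D, x ∉ B → G.avg u x = u x) ∧ ∀ x, 0 ≤ u x ∧ u x ≤ 1 := by
  classical
  have hF : (D \ B).Finite := hD.subset Set.sdiff_subset
  obtain ⟨u, hu, huh⟩ := hp.exists_dirichlet hF (fun x => if x ∈ B then 1 else 0) (fun _ => 0)
  have hB (x : V) (hx : x ∈ B) : u x = 1 := by rw [hu x fun h => h.2 hx, if_pos hx]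
  have hD0 (x : V) (hx : x ∉ D) : u x = 0 := by
    rw [hu x fun h => hx h.1, if_neg fun h => hx (hBD h)]
  have hout (x : V) (hx : x ∉ D \ B) : 0 ≤ u x ∧ u x ≤ 1 := by
    rw [hu x hx]
    split_ifs <;> norm_num
  refine ⟨u, hB, hD0, fun x hx hxB => ?_, fun x => ⟨?_, ?_⟩⟩
  · linarith [huh x ⟨hx, hxB⟩]
  · exact hp.le_of_superharmonic hF (f := fun _ => 0)
      (fun y hy => by rw [huh y hy, hp.avg_const]; simp) (fun y hy => (hout y hy).1) x
  · exact hp.le_of_superharmonic hF (g := fun _ => 1)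
      (fun y hy => by rw [huh y hy, hp.avg_const]; simp) (fun y hy => (hout y hy).2) x

/-- Harmonic extension into a finite set of a function. -/
theorem P0.exists_harmonic_extension (hp : G.P0) {D : Set V} (hD : D.Finite) (f : V → ℝ) :
    ∃ h : V → ℝ, (∀ x ∉ D, h x = f x) ∧ ∀ x ∈ D, G.avg h x = h x := by
  obtain ⟨h, h1, h2⟩ := hp.exists_dirichlet hD f (fun _ => 0)
  exact ⟨h, h1, fun x hx => by linarith [h2 x hx]⟩

end Harnack

end

/-! ### Chaining hitting estimates with control of the time. -/

section

variable {V : Type*} {G : WeightedGraph V}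

/-! ### Lower bounds for exit probabilities along a chain of balls -/

section Chain

variable [Infinite V] [MeasurableSpace V] [DiscreteMeasurableSpace V]

theorem exitProb_mono (A : Set V) {m n : ℕ} (h : m ≤ n) (x : V) :
    G.exitProb A m x ≤ G.exitProb A n x :=
  measureReal_mono fun ω (hω : exitTime A ω < m) => hω.trans_le (by exact_mod_cast h)

/-- A comparison principle: `h` plays the role of the probability of a way of leaving `A`, and `t`
that of the mean time it takes, restricted to this event. -/
theorem P0.sub_le_exitProb (hp : G.P0) {A F : Set V} {N : ℕ} {h t : V → ℝ}
    (hh : ∀ w ∈ F, h w ≤ G.avg h w) (ht : ∀ w ∈ F, G.avg t w + h w ≤ t w) (ht0 : ∀ w ∈ F, 0 ≤ t w)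
    (hF : ∀ w ∉ F, ∀ n ≤ N, n * h w - t w ≤ N * G.exitProb A n w) {n : ℕ} (hn : n ≤ N) (w : V) :
    n * h w - t w ≤ N * G.exitProb A n w := by
  induction n generalizing w with
  | zero =>
    by_cases hw : w ∈ F
    · rw [exitProb_zero]
      push_cast
      linarith [ht0 w hw]
    · exact hF w hw 0 hn
  | succ n ih =>
    by_cases hw : w ∈ F
    · have h1 : G.avg (fun y => n * h y - t y) w ≤ G.avg (fun y => N * G.exitProb A n y) w :=
        G.avg_mono fun y _ => ih (by lia) y
      rw [avg_sub, avg_smul, avg_smul] at h1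
      have h2 := mul_le_mul_of_nonneg_left (hp.avg_exitProb_le A n w) (Nat.cast_nonneg (α := ℝ) N)
      have h3 := mul_le_mul_of_nonneg_left (hh w hw) (Nat.cast_nonneg (α := ℝ) n)
      push_cast
      linarith [ht w hw]
    · exact hF w hw _ hn

/-- Carries a bound from B to all starting points: the walk that leaves D before B is given up. The
mean exit time transports the error already present on B, and its decrease γ ≥ 1 ≥ u per step also
pays for the time needed to reach B. -/
theorem P0.exitProb_ge_of_hitting (hp : G.P0) {A B D : Set V} (hD : D.Finite) {N : ℕ} {u : V → ℝ}
    (hu1 : ∀ x ∈ B, u x = 1) (hu0 : ∀ x ∉ D, u x = 0)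
    (hharm : ∀ x ∈ D, x ∉ B → G.avg u x = u x) (hu : ∀ x, 0 ≤ u x ∧ u x ≤ 1)
    {κ b γ : ℝ} (hκ : 0 ≤ κ) (hb : 0 ≤ b) (hγ : 1 ≤ γ)
    (hB : ∀ v ∈ B, ∀ n ≤ N, κ * ((n - b) - γ * G.exitMean D v) ≤ N * G.exitProb A n v)
    {n : ℕ} (hn : n ≤ N) (w : V) :
    κ * ((n - b) * u w - γ * G.exitMean D w) ≤ N * G.exitProb A n w := by
  have := hp.sub_le_exitProb (A := A) (F := D \ B) (N := N) (h := fun w => κ * u w)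
    (t := fun w => κ * (b * u w + γ * G.exitMean D w))
    (fun w hw => by rw [avg_smul, hharm w hw.1 hw.2])
    (fun w hw => by
      rw [avg_smul, avg_add, avg_smul, avg_smul, hharm w hw.1 hw.2, hp.avg_exitMean hD hw.1,
        ← mul_add]
      refine mul_le_mul_of_nonneg_left ?_ hκ
      linarith [(hu w).2])
    (fun w _ => mul_nonneg hκ (add_nonneg (mul_nonneg hb (hu w).1)
      (mul_nonneg (by linarith) (G.exitMean_nonneg D w))))
    (fun w hw n hn => by
      by_cases hwB : w ∈ B
      · refine le_trans (le_of_eq ?_) (hB w hwB n hn)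
        rw [hu1 w hwB]
        ring
      · have hwD : w ∉ D := fun h => hw ⟨h, hwB⟩
        rw [hu0 w hwD, G.exitMean_of_notMem hwD]
        simpa using mul_nonneg (Nat.cast_nonneg (α := ℝ) N) (G.exitProb_nonneg A n w)) hn w
  refine le_trans (le_of_eq ?_) this
  ring

/-- Replaces u and e by functions harmonic on F, to which (H) applies. The time spent in F is
charged to the mean exit time of any D containing F. -/
theorem P0.exitProb_ge_of_extension (hp : G.P0) {A D F : Set V} (hD : D.Finite) (hFD : F ⊆ D)
    {N : ℕ} {u e Hu He : V → ℝ} (hHu : ∀ x ∉ F, Hu x = u x) (hHe : ∀ x ∉ F, He x = e x)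
    (hHuh : ∀ x ∈ F, G.avg Hu x = Hu x) (hHeh : ∀ x ∈ F, G.avg He x = He x)
    (hHu01 : ∀ x, 0 ≤ Hu x ∧ Hu x ≤ 1) (hHe0 : ∀ x, 0 ≤ He x)
    {κ b γ : ℝ} (hκ : 0 ≤ κ) (hb : 0 ≤ b) (hγ : 0 ≤ γ)
    (hue : ∀ n ≤ N, ∀ w, κ * ((n - b) * u w - γ * e w) ≤ N * G.exitProb A n w)
    {n : ℕ} (hn : n ≤ N) (w : V) :
    κ * ((n - b) * Hu w - γ * He w - G.exitMean D w) ≤ N * G.exitProb A n w := by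
  have := hp.sub_le_exitProb (A := A) (F := F) (N := N) (h := fun w => κ * Hu w)
    (t := fun w => κ * (b * Hu w + γ * He w + G.exitMean D w))
    (fun w hw => by rw [avg_smul, hHuh w hw])
    (fun w hw => by
      rw [avg_smul, avg_add, avg_add, avg_smul, avg_smul, hHuh w hw, hHeh w hw,
        hp.avg_exitMean hD (hFD hw), ← mul_add]
      refine mul_le_mul_of_nonneg_left ?_ hκ
      linarith [(hHu01 w).2])
    (fun w _ => mul_nonneg hκ (add_nonneg (add_nonneg (mul_nonneg hb (hHu01 w).1)
      (mul_nonneg hγ (hHe0 w))) (G.exitMean_nonneg D w)))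
    (fun w hw n hn => by
      refine le_trans ?_ (hue n hn w)
      rw [hHu w hw, hHe w hw]
      have := mul_nonneg hκ (G.exitMean_nonneg D w)
      nlinarith) hn w
  refine le_trans (le_of_eq ?_) this
  ring

variable (G) in
/-- The properties of the probability of hitting `B` before leaving `D`. -/
structure IsHitting (D B : Set V) (u : V → ℝ) : Prop where
  eq_one : ∀ x ∈ B, u x = 1
  eq_zero : ∀ x ∉ D, u x = 0
  harmonic : ∀ x ∈ D, x ∉ B → G.avg u x = u x
  mem_Icc : ∀ x, 0 ≤ u x ∧ u x ≤ 1

/-- The bounds obtained by harmonic extension of `u` and of the mean exit time from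
`cball z (72 * k)` into `cball z (24 * k)`. -/
theorem HarnackWith.exists_extension (hp : G.P0) {C : ℝ} (hH : G.HarnackWith C) (hC : 1 ≤ C)
    {k : ℕ} (hk : 1 ≤ k) {z z' : V} (hzz' : G.graph.dist z z' ≤ 12 * k) {u : V → ℝ}
    (hu : G.IsHitting (G.cball z (72 * k)) (G.cball z' (12 * k)) u) :
    ∃ Hu He : V → ℝ, (∀ x ∉ G.cball z (2 * (12 * k)), Hu x = u x) ∧
      (∀ x ∉ G.cball z (2 * (12 * k)), He x = G.exitMean (G.cball z (72 * k)) x) ∧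
      (∀ x ∈ G.cball z (2 * (12 * k)), G.avg Hu x = Hu x) ∧
      (∀ x ∈ G.cball z (2 * (12 * k)), G.avg He x = He x) ∧
      (∀ x, 0 ≤ Hu x ∧ Hu x ≤ 1) ∧ (∀ x, 0 ≤ He x) ∧
      (∀ x ∈ G.cball z (12 * k), (C ^ 60)⁻¹ ≤ Hu x) ∧
      ∀ x ∈ G.cball z (12 * k), He x ≤ C * G.exitMean (G.cball z (72 * k)) z := by
  have hF : (G.cball z (2 * (12 * k))).Finite := hp.finite_cball z _
  have hD : (G.cball z (72 * k)).Finite := hp.finite_cball z _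
  obtain ⟨Hu, hHu, hHuh⟩ := hp.exists_harmonic_extension hF u
  obtain ⟨He, hHe, hHeh⟩ := hp.exists_harmonic_extension hF (G.exitMean (G.cball z (72 * k)))
  have hHe0 (x : V) : 0 ≤ He x := hp.le_of_superharmonic hF (f := fun _ => 0)
    (fun y hy => by rw [hHeh y hy, hp.avg_const]; simp)
    (fun y hy => by rw [hHe y hy]; exact G.exitMean_nonneg _ y) x
  refine ⟨Hu, He, hHu, hHe, hHuh, hHeh, fun x => ⟨?_, ?_⟩, hHe0, fun x hx => ?_, fun x hx => ?_⟩
  · exact hp.le_of_superharmonic hF (f := fun _ => 0)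
      (fun y hy => by rw [hHuh y hy, hp.avg_const]; simp)
      (fun y hy => by rw [hHu y hy]; exact (hu.mem_Icc y).1) x
  · exact hp.le_of_superharmonic hF (g := fun _ => 1)
      (fun y hy => by rw [hHuh y hy, hp.avg_const]; simp)
      (fun y hy => by rw [hHu y hy]; exact (hu.mem_Icc y).2) x
  · have h1 := hp.nonneg_of_superharmonic hF (f := fun x => Hu x - (C ^ 60)⁻¹)
      (fun y hy => by rw [avg_sub, hHuh y hy, hp.avg_const])
      (fun y hy w hyw hw => by
        rw [hHu w hw, sub_nonneg]
        -- The lower bound is needed only just outside the ball of radius 24k: there the distance to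
        -- z' is at most 24k + 1 + 12k ≤ 48k.
        refine hH.le_hitting hp hC hD hk (z := z') (fun v hv => ?_) hu.eq_one hu.eq_zero
          hu.harmonic ?_
        · have := G.dist_triangle z z' v
          rw [mem_cball] at hv ⊢
          lia
        · have h2 := G.dist_le_succ_of_adj (x := z) hyw
          have h3 := G.dist_triangle z' z w
          rw [G.graph.dist_comm (u := z') (v := z)] at h3
          rw [mem_cball] at hy
          lia) x (by rw [mem_cball] at hx ⊢; lia)
    linarith
  · have h1 := hH z (12 * k) He hHe0 hHeh x hx z (by simp [mem_cball])
    refine h1.trans (mul_le_mul_of_nonneg_left ?_ (by linarith))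
    -- The mean exit time is superharmonic, so its harmonic extension lies below it, in particular
    -- at the centre.
    refine hp.le_of_superharmonic hF (fun y hy => ?_) (fun y hy => (hHe y hy).le) z
    rw [hHeh y hy, hp.avg_exitMean hD (by rw [mem_cball] at hy ⊢; lia)]
    linarith

theorem HarnackWith.exitProb_ge_of_chain (hp : G.P0) {C : ℝ} (hH : G.HarnackWith C) (hC : 1 ≤ C)
    {k : ℕ} (hk : 1 ≤ k) {A : Set V} {z : ℕ → V} {I N : ℕ} {M : ℝ}
    (hz : ∀ i ≤ I, G.graph.dist (z i) (z (i + 1)) ≤ 12 * k)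
    (hA : ∀ w ∈ G.cball (z (I + 1)) (12 * k), w ∉ A)
    (hM : ∀ i ≤ I, G.exitMean (G.cball (z i) (72 * k)) (z i) ≤ M)
    (hN : 4 * (I + 1) * (C ^ 60) ^ 2 * C * M ≤ N) :
    (C ^ 60)⁻¹ ^ (I + 1) / 2 ≤ G.exitProb A N (z 0) := by
  set K : ℝ := C ^ 60 with hK
  have hK1 : 1 ≤ K := one_le_pow₀ hC
  have hK0 : 0 < K := by linarith
  have hM1 : 1 ≤ M := (hp.one_le_exitMean (hp.finite_cball (z 0) (72 * k))
    (by simp [mem_cball])).trans (hM 0 (Nat.zero_le _))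
  -- The time cost of one ball: each stage adds an error K·C·M next to (n − dB)·K⁻¹, and factoring
  -- out K⁻¹ turns it into K²·C·M.
  set B : ℝ := K ^ 2 * C * M with hB
  have hB0 : 0 ≤ B := by positivity
  have hD (i : ℕ) : (G.cball (z i) (72 * k)).Finite := hp.finite_cball _ _
  have hex : ∀ i : ℕ, i ≤ I → ∃ u : V → ℝ,
      G.IsHitting (G.cball (z i) (72 * k)) (G.cball (z (i + 1)) (12 * k)) u := fun i hi => by
    obtain ⟨u, h1, h2, h3, h4⟩ := hp.exists_hitting (hD i)
      (B := G.cball (z (i + 1)) (12 * k)) fun v hv => by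
        have := G.dist_triangle (z i) (z (i + 1)) v
        have := hz i hi
        rw [mem_cball] at hv ⊢
        lia
    exact ⟨u, h1, h2, h3, h4⟩
  choose! u hu using hex
  -- Backward induction along the chain. The mean exit time stays a function of w, since `hM` bounds
  -- it only at the centre.
  have key : ∀ d i, i + d = I → ∀ n ≤ N, ∀ w, K⁻¹ ^ d *
      ((n - d * B) * u i w - K * G.exitMean (G.cball (z i) (72 * k)) w) ≤
        N * G.exitProb A n w := by
    intro d
    induction d with
    | zero =>
      intro i hi n hn w
      have hi' : i = I := by lia
      subst hi'
      obtain ⟨h1, h2, h3, h4⟩ := hu i le_rfl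
      refine hp.exitProb_ge_of_hitting (hD i) h1 h2 h3 h4 (by positivity) (by simp) hK1 ?_ hn w
      intro v hv n hn
      have h5 : 0 ≤ K * G.exitMean (G.cball (z i) (72 * k)) v :=
        mul_nonneg hK0.le (G.exitMean_nonneg _ v)
      have h6 : (n : ℝ) ≤ N := by exact_mod_cast hn
      cases n with
      | zero =>
        rw [exitProb_zero]
        simpa using h5
      | succ n =>
        rw [exitProb_succ_of_notMem _ (hA v hv)]
        simp only [pow_zero, CharP.cast_eq_zero]
        linarith
    | succ d ih =>
      intro i hi n hn w
      obtain ⟨h1, h2, h3, h4⟩ := hu i (by lia)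
      refine hp.exitProb_ge_of_hitting (hD i) h1 h2 h3 h4 (by positivity) (by positivity) hK1 ?_ hn w
      intro v hv n hn
      obtain ⟨Hu, He, e1, e2, e3, e4, e5, e6, e7, e8⟩ :=
        hH.exists_extension hp hC hk (hz (i + 1) (by lia)) (hu (i + 1) (by lia))
      -- The time in F is charged to the previous domain, whose mean exit time the resulting bound
      -- carries anyway; after factoring out K⁻¹ its weight is exactly K.
      have h5 := hp.exitProb_ge_of_extension (hD i) (F := G.cball (z (i + 1)) (2 * (12 * k)))
        (fun v hv => by
          have := G.dist_triangle (z i) (z (i + 1)) v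
          have := hz i (by lia)
          rw [mem_cball] at hv ⊢
          lia) e1 e2 e3 e4 e5 e6 (κ := K⁻¹ ^ d) (b := d * B) (γ := K) (by positivity) (by positivity)
        hK0.le (ih (i + 1) (by lia)) hn v
      have hX := e7 v hv
      have hY : He v ≤ C * M := (e8 v hv).trans
        (mul_le_mul_of_nonneg_left (hM (i + 1) (by lia)) (by linarith))
      have hE := G.exitMean_nonneg (G.cball (z i) (72 * k)) v
      have hq : 0 ≤ N * G.exitProb A n v :=
        mul_nonneg (Nat.cast_nonneg N) (G.exitProb_nonneg A n v)
      rw [← hK] at hX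
      set X := Hu v
      have hX0 : 0 < X := (inv_pos.2 hK0).trans_le hX
      -- As n − dB may be negative, X cannot simply be replaced by its lower bound K⁻¹. Multiplying
      -- the whole inequality by θ ≤ 1 does so, and is harmless on the nonnegative right-hand side.
      set θ := K⁻¹ / X with hθ
      have hθ0 : 0 ≤ θ := by positivity
      have hθ1 : θ ≤ 1 := (div_le_one hX0).2 hX
      have hθX : θ * X = K⁻¹ := div_mul_cancel₀ _ hX0.ne'
      have h6 : θ * (K * He v + G.exitMean (G.cball (z i) (72 * k)) v) ≤
          K * (C * M) + G.exitMean (G.cball (z i) (72 * k)) v := by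
        have h7 : 0 ≤ K * He v + G.exitMean (G.cball (z i) (72 * k)) v :=
          add_nonneg (mul_nonneg hK0.le (e6 v)) hE
        refine (mul_le_of_le_one_left h7 hθ1).trans ?_
        have := mul_le_mul_of_nonneg_left hY hK0.le
        linarith
      calc K⁻¹ ^ (d + 1) * ((n - (d + 1 : ℕ) * B) - K * G.exitMean (G.cball (z i) (72 * k)) v)
          = K⁻¹ ^ d * ((n - d * B) * (θ * X) -
              (K * (C * M) + G.exitMean (G.cball (z i) (72 * k)) v)) := by
            rw [hθX, hB, pow_succ]
            push_cast
            field_simp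
            ring
        _ ≤ K⁻¹ ^ d * ((n - d * B) * (θ * X) -
              θ * (K * He v + G.exitMean (G.cball (z i) (72 * k)) v)) := by
            refine mul_le_mul_of_nonneg_left ?_ (by positivity)
            linarith
        _ = θ * (K⁻¹ ^ d * ((n - d * B) * X - K * He v -
              G.exitMean (G.cball (z i) (72 * k)) v)) := by ring
        _ ≤ θ * (N * G.exitProb A n v) := mul_le_mul_of_nonneg_left h5 hθ0
        _ ≤ N * G.exitProb A n v := mul_le_of_le_one_left hq hθ1
  obtain ⟨Hu, He, e1, e2, e3, e4, e5, e6, e7, e8⟩ :=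
    hH.exists_extension hp hC hk (hz 0 (Nat.zero_le _)) (hu 0 (Nat.zero_le _))
  have h5 := hp.exitProb_ge_of_extension (hD 0) (F := G.cball (z 0) (2 * (12 * k)))
    (fun v hv => by rw [mem_cball] at hv ⊢; lia) e1 e2 e3 e4 e5 e6 (κ := K⁻¹ ^ I) (b := I * B)
    (γ := K) (by positivity) (by positivity) hK0.le (key I 0 (by lia)) le_rfl (z 0)
  have hz0 : z 0 ∈ G.cball (z 0) (12 * k) := by simp [mem_cball]
  have hX := e7 _ hz0
  have hY : He (z 0) ≤ C * M := (e8 _ hz0).trans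
    (mul_le_mul_of_nonneg_left (hM 0 (Nat.zero_le _)) (by linarith))
  have hE := hM 0 (Nat.zero_le _)
  have hN0 : (0 : ℝ) < N := lt_of_lt_of_le (by positivity) hN
  have hNB : 4 * (I + 1) * B ≤ N := by
    refine le_trans (le_of_eq ?_) hN
    rw [hB]
    ring
  have hIB : 0 ≤ N - I * B := by nlinarith
  have hKB : K⁻¹ * B = K * (C * M) := by
    rw [hB]
    field_simp
  have hMB : M ≤ K * (C * M) := by
    have : 1 ≤ K * C := one_le_mul_of_one_le_of_one_le hK1 hC
    nlinarith
  have h6 : K⁻¹ * (N / 2) ≤ (N - I * B) * Hu (z 0) - K * He (z 0) -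
      G.exitMean (G.cball (z 0) (72 * k)) (z 0) := by
    have h7 := mul_le_mul_of_nonneg_left hX hIB
    have h8 := mul_le_mul_of_nonneg_left hY hK0.le
    have h9 : K⁻¹ * (N / 2) ≤ K⁻¹ * (N - I * B - 2 * B) :=
      mul_le_mul_of_nonneg_left (by nlinarith) (inv_pos.2 hK0).le
    rw [← hK] at h7
    linarith
  have h7 : K⁻¹ ^ I * (K⁻¹ * (N / 2)) ≤ N * G.exitProb A N (z 0) :=
    (mul_le_mul_of_nonneg_left h6 (by positivity)).trans h5
  refine le_of_mul_le_mul_left (le_trans (le_of_eq ?_) h7) hN0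
  rw [pow_succ]
  ring

/-- Following a geodesic to y puts the walk outside A at time j at the latest, that is before time j
+ 1. -/
theorem P0.exitProb_ge_pow (hp : G.P0) {p₀ : ℝ} (hp₀ : 0 ≤ p₀)
    (h : ∀ x y, G.graph.Adj x y → p₀ ≤ G.p x y) {A : Set V} {y : V} (hy : y ∉ A) {j : ℕ} {x : V}
    (hxy : G.graph.dist y x = j) : p₀ ^ j ≤ G.exitProb A (j + 1) x := by
  induction j generalizing x with
  | zero =>
    rw [G.connected.dist_eq_zero_iff] at hxy
    rw [← hxy, exitProb_succ_of_notMem _ hy, pow_zero]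
  | succ j ih =>
    obtain ⟨v, hv, hvx⟩ := G.exists_adj_of_dist_eq_succ hxy
    refine le_trans ?_ (hp.avg_exitProb_le A (j + 1) x)
    rw [pow_succ']
    refine (mul_le_mul (h x v hvx.symm) (ih hv) (by positivity) (G.p_nonneg x v)).trans ?_
    exact Finset.single_le_sum (f := fun y => G.p x y * G.exitProb A (j + 1) y)
      (fun y _ => mul_nonneg (G.p_nonneg x y) (G.exitProb_nonneg A (j + 1) y))
      (hp.mem_nbrs.2 hvx.symm)

end Chain

end

/-! ### Lower bound: choice of the chain and of the constants. -/

section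

variable {V : Type*} {G : WeightedGraph V}

/-! ### The lower bound -/

theorem dist_getVert_le {x y : V} (w : G.graph.Walk x y) {a b : ℕ} (h : a ≤ b) :
    G.graph.dist (w.getVert a) (w.getVert b) ≤ b - a := by
  have h1 := SimpleGraph.dist_le ((w.drop a).take (b - a))
  rw [SimpleGraph.Walk.take_length] at h1
  have h2 : (w.drop a).getVert (b - a) = w.getVert b := by
    rw [SimpleGraph.Walk.drop_getVert]
    congr 1
    lia
  exact h2 ▸ h1.trans (min_le_left _ _)

theorem dist_getVert_of_length_eq {x y : V} {w : G.graph.Walk x y}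
    (hw : w.length = G.graph.dist x y) {a : ℕ} (ha : a ≤ w.length) :
    G.graph.dist x (w.getVert a) = a := by
  have h1 := G.dist_getVert_le w (Nat.zero_le a)
  have h2 := G.dist_getVert_le w ha
  rw [SimpleGraph.Walk.getVert_zero] at h1
  rw [SimpleGraph.Walk.getVert_length] at h2
  have := G.dist_triangle x (w.getVert a) y
  lia

variable [Infinite V]

theorem P0.finite_sphere (hp : G.P0) (x : V) (R : ℝ) : (G.sphere x R).Finite := by
  refine (hp.finite_cball x ⌈R⌉₊).subset fun y hy => ?_
  have h1 : (G.graph.dist x y : ℝ) = R := hy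
  rw [mem_cball, ← h1, Nat.ceil_natCast]

theorem P0.nonempty_sphere (hp : G.P0) (x : V) (m : ℕ) : (G.sphere x m).Nonempty := by
  obtain ⟨y, hy⟩ := (hp.finite_cball x m).exists_notMem
  obtain ⟨z, hz, -⟩ := G.exists_between (not_le.1 hy).le
  exact ⟨z, by simp [sphere, hz]⟩

theorem P0.exists_le_p (hp : G.P0) :
    ∃ p₀ : ℝ, 0 < p₀ ∧ p₀ ≤ 1 ∧ ∀ x y, G.graph.Adj x y → p₀ ≤ G.p x y := by
  obtain ⟨p₀, h0, h⟩ := hp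
  refine ⟨min p₀ 1, lt_min (by exact_mod_cast h0) one_pos, min_le_right _ _, fun x y hxy => ?_⟩
  have := ENNReal.toReal_mono (PMF.apply_ne_top _ _) (h x y hxy)
  exact (min_le_left _ _).trans this

variable [MeasurableSpace V] [DiscreteMeasurableSpace V]

/-- The default value is R itself, so a value below R is a genuine solution. -/
theorem exists_nat_of_l_lt {Q : ℝ≥0} {C : ℝ} {x y : V} {n : ℕ} {R : ℝ} (h : G.l Q C x y n R < R) :
    ∃ l : ℕ, 1 ≤ l ∧ G.l Q C x y n R = l ∧
      (Q : ℝ≥0∞) * ⨆ z ∈ G.geodesics x y, G.E z (C * R / l) ≤ (n : ℝ≥0∞) / l := by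
  classical
  unfold WeightedGraph.l at h ⊢
  split_ifs at h ⊢ with hex
  · have hs := Nat.find_spec hex
    refine ⟨Nat.find hex, hs.1, ?_, hs.2⟩
    norm_cast
  · exact absurd h (lt_irrefl _)

theorem l_nonneg (Q : ℝ≥0) (C : ℝ) (x y : V) (n : ℕ) {R : ℝ} (hR : 0 ≤ R) :
    0 ≤ G.l Q C x y n R := by
  unfold WeightedGraph.l
  split_ifs
  · positivity
  · exact hR

theorem HarnackWith.exitProb_ge_of_l (hp : G.P0) {C : ℝ} (hH : G.HarnackWith C) (hC : 1 ≤ C)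
    {Q : ℝ≥0} (hQ : (Q : ℝ) = 24 * (C ^ 60) ^ 2 * C) {x y : V} {R : ℝ} (hR : 0 < R) {n l : ℕ}
    (hy : (G.graph.dist x y : ℝ) = 2 * R) (hl : 1 ≤ l) (hlR : 24 * (l : ℝ) ≤ R)
    (h : (Q : ℝ≥0∞) * ⨆ z ∈ G.geodesics x y, G.E z (9 * R / l) ≤ (n : ℝ≥0∞) / l) :
    (C ^ 60)⁻¹ ^ (6 * l) / 2 ≤ G.exitProb (G.ball x R) n x := by
  have hl0 : (1 : ℝ) ≤ l := by exact_mod_cast hl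
  have hQ0 : (0 : ℝ) < Q := by rw [hQ]; positivity
  -- So 24kl ≤ R ≤ 48kl. The first inequality fits balls of radius 72k into B(z,9R/l) and the chain
  -- into a geodesic of length 2R; the second bounds its number of steps by 6l.
  set k : ℕ := ⌊R / (24 * l)⌋₊ with hkdef
  have hRl : 1 ≤ R / (24 * l) := by rw [le_div_iff₀ (by positivity)]; linarith
  have hk : 1 ≤ k := Nat.le_floor (by exact_mod_cast hRl)
  have hk1 : (1 : ℝ) ≤ k := by exact_mod_cast hk
  have hkle : (k : ℝ) * (24 * l) ≤ R := by
    rw [← le_div_iff₀ (by positivity)]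
    exact Nat.floor_le (by positivity)
  have hkgt : R ≤ k * (48 * l) := by
    have h1 : R / (24 * l) < k + 1 := Nat.lt_floor_add_one _
    rw [div_lt_iff₀ (by positivity)] at h1
    nlinarith
  -- The ball of radius 12k about the point at distance (I + 1)·12k from x then misses B(x,R).
  set I : ℕ := ⌈R / (12 * k)⌉₊ with hIdef
  have hIge : R ≤ I * (12 * k) := by
    rw [← div_le_iff₀ (by positivity)]
    exact Nat.le_ceil _
  have hIlt : (I : ℝ) * (12 * k) < R + 12 * k := by
    have h1 : (I : ℝ) < R / (12 * k) + 1 := Nat.ceil_lt_add_one (by positivity)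
    rw [div_add_one (by positivity), lt_div_iff₀ (by positivity)] at h1
    exact h1
  have hI4 : (I : ℝ) ≤ 4 * l + 1 := by nlinarith
  have hI6 : I + 1 ≤ 6 * l := by
    have : (I : ℝ) + 1 ≤ 6 * l := by linarith
    exact_mod_cast this
  obtain ⟨w, hw⟩ := G.connected.exists_walk_length_eq_dist x y
  have hgeo (i : ℕ) : w.getVert i ∈ G.geodesics x y := ⟨w, hw, w.getVert_mem_support i⟩
  have hlen : (I + 1) * (12 * k) ≤ w.length := by
    have : ((I : ℝ) + 1) * (12 * k) ≤ w.length := by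
      rw [hw, hy]
      nlinarith
    exact_mod_cast this
  have hchain := hH.exitProb_ge_of_chain hp hC hk (A := G.ball x R)
    (z := fun i => w.getVert (i * (12 * k))) (I := I) (N := n) (M := n / (l * Q))
    (fun i _ => by
      have := G.dist_getVert_le w (a := i * (12 * k)) (b := (i + 1) * (12 * k)) (by lia)
      refine this.trans (le_of_eq ?_)
      rw [Nat.succ_mul]
      lia) (fun v hv hvA => ?_) (fun i _ => ?_) ?_
  · simp only [zero_mul, SimpleGraph.Walk.getVert_zero] at hchain
    refine le_trans ?_ hchain
    have h1 : (C ^ 60)⁻¹ ≤ 1 := inv_le_one_of_one_le₀ (one_le_pow₀ hC)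
    have := pow_le_pow_of_le_one (by positivity) h1 hI6
    linarith
  · have h1 := dist_getVert_of_length_eq hw hlen
    have h2 := G.dist_triangle x v (w.getVert ((I + 1) * (12 * k)))
    rw [mem_cball, SimpleGraph.dist_comm] at hv
    have h3 : (I + 1) * (12 * k) ≤ G.graph.dist x v + 12 * k := by lia
    have h4 : ((I : ℝ) + 1) * (12 * k) ≤ G.graph.dist x v + 12 * k := by exact_mod_cast h3
    have h5 : (G.graph.dist x v : ℝ) < R := hvA
    linarith
  · set z := w.getVert (i * (12 * k))
    have h1 : (Q : ℝ≥0∞) * G.E z (9 * R / l) ≤ (n : ℝ≥0∞) / l :=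
      le_trans (by gcongr; exact le_iSup₂ (f := fun z _ => G.E z (9 * R / l)) z (hgeo _)) h
    have h2 : G.meanExit (G.cball z (72 * k)) z ≤ G.E z (9 * R / l) := by
      refine G.meanExit_mono (fun v hv => ?_) z
      have h3 : (G.graph.dist z v : ℝ) ≤ 72 * k := by exact_mod_cast hv
      change (G.graph.dist z v : ℝ) < 9 * R / l
      refine h3.trans_lt ?_
      rw [lt_div_iff₀ (by positivity)]
      nlinarith
    have h3 := ENNReal.toReal_mono
      (ENNReal.div_ne_top (ENNReal.natCast_ne_top n) (by exact_mod_cast (show l ≠ 0 by lia)))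
      ((by gcongr : (Q : ℝ≥0∞) * G.meanExit (G.cball z (72 * k)) z ≤ _).trans h1)
    rw [ENNReal.toReal_mul, ENNReal.toReal_div, ENNReal.coe_toReal, ENNReal.toReal_natCast,
      ENNReal.toReal_natCast] at h3
    change (Q : ℝ) * G.exitMean (G.cball z (72 * k)) z ≤ n / l at h3
    rw [le_div_iff₀ (by positivity)] at h3 ⊢
    linarith
  · have h1 : ((I : ℝ) + 1) ≤ 6 * l := by exact_mod_cast hI6
    have h2 : 4 * ((I : ℝ) + 1) * (C ^ 60) ^ 2 * C ≤ l * Q := by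
      rw [hQ]
      have : 0 ≤ (C ^ 60) ^ 2 * C := by positivity
      nlinarith
    calc 4 * ((I : ℝ) + 1) * (C ^ 60) ^ 2 * C * (n / (l * Q)) ≤ l * Q * (n / (l * Q)) := by gcongr
      _ = n := by field_simp

theorem P0.exitProb_ge_rpow (hp : G.P0) {p₀ : ℝ} (h0 : 0 < p₀) (h1 : p₀ ≤ 1)
    (h : ∀ x y, G.graph.Adj x y → p₀ ≤ G.p x y) {x : V} {R : ℝ} (hR : 0 < R) {n : ℕ}
    (hn : R + 1 ≤ n) :
    p₀ * p₀ ^ R ≤ G.exitProb (G.ball x R) n x := by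
  obtain ⟨y, hy⟩ := hp.nonempty_sphere x ⌈R⌉₊
  have hy' : G.graph.dist x y = ⌈R⌉₊ := Nat.cast_injective (R := ℝ) hy
  have hyA : y ∉ G.ball x R := fun hyR => by
    have h2 : (G.graph.dist x y : ℝ) < R := hyR
    rw [hy'] at h2
    exact absurd (Nat.le_ceil R) (not_le.2 h2)
  have h2 := hp.exitProb_ge_pow h0.le h hyA (x := x) (j := ⌈R⌉₊) (by rw [SimpleGraph.dist_comm, hy'])
  have h3 : ⌈R⌉₊ + 1 ≤ n := by
    have : 1 ≤ n := by
      have : (1 : ℝ) ≤ n := by linarith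
      exact_mod_cast this
    have : ⌈R⌉₊ ≤ n - 1 := by
      refine Nat.ceil_le.2 ?_
      rw [Nat.cast_sub this]
      push_cast
      linarith
    lia
  refine le_trans ?_ (h2.trans (G.exitProb_mono _ h3 x))
  rw [← Real.rpow_natCast, ← Real.rpow_one_add' h0.le (by positivity)]
  refine Real.rpow_le_rpow_of_exponent_ge h0 h1 ?_
  linarith [Nat.ceil_lt_add_one hR.le]

theorem EllipticHarnack.exitProb_ge (hp : G.P0) (h : G.EllipticHarnack) :
    ∃ Q : ℝ≥0, 0 < Q ∧ ∃ c : ℝ, 0 < c ∧ ∃ C : ℝ, 0 < C ∧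
      ∀ (x : V) (R : ℝ) (n : ℕ), 0 < R → (∃ m : ℕ, 2 * R = m) → R + 1 ≤ n →
        c * Real.exp (-C * G.nu Q x n R) ≤ G.exitProb (G.ball x R) n x := by
  obtain ⟨C, hC, hH⟩ := h.harnackWith hp
  obtain ⟨p₀, h0, h1, hpp⟩ := hp.exists_le_p
  have hC60 : 1 ≤ C ^ 60 := one_le_pow₀ hC
  -- The chain needs time 4(I + 1)K²CM with K = C^60 and I + 1 ≤ 6l, whence 24.
  set Q : ℝ≥0 := ⟨24 * (C ^ 60) ^ 2 * C, by positivity⟩ with hQdef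
  have hQ : (Q : ℝ) = 24 * (C ^ 60) ^ 2 * C := rfl
  have hQ0 : 0 < Q := by
    rw [← NNReal.coe_pos, hQ]
    positivity
  set a : ℝ := Real.log (C ^ 60) with ha
  have ha0 : 0 ≤ a := Real.log_nonneg hC60
  set b : ℝ := -Real.log p₀ with hb
  have hb0 : 0 ≤ b := by
    have := Real.log_nonpos h0.le h1
    linarith
  -- The term 6a pays for 6l factors C^{-60} and 24b for p₀^R when R < 24l; the 1 only ensures
  -- positivity.
  refine ⟨Q, hQ0, min (1 / 2) p₀, lt_min (by norm_num) h0, 6 * a + 24 * b + 1, by positivity, ?_⟩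
  rintro x R n hR ⟨m, hm⟩ hn
  have hmem : G.nu Q x n R ∈ (fun y => G.l Q 9 x y n R) '' G.sphere x (2 * R) := by
    refine Set.Nonempty.csInf_mem ?_ ((hp.finite_sphere x (2 * R)).image _)
    rw [hm]
    exact (hp.nonempty_sphere x m).image _
  obtain ⟨y, hy, hν⟩ := hmem
  rw [← hν]
  have hl0 : 0 ≤ G.l Q 9 x y n R := l_nonneg Q 9 x y n hR.le
  -- The second case includes the default l = R, and also l too large for a chain with k ≥ 1.
  by_cases hl : 24 * G.l Q 9 x y n R ≤ R
  · have hlt : G.l Q 9 x y n R < R := by linarith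
    obtain ⟨l, hl1, hleq, hlE⟩ := exists_nat_of_l_lt hlt
    simp only [hleq] at hl ⊢
    have h2 := hH.exitProb_ge_of_l hp hC hQ hR hy hl1 hl hlE
    refine le_trans ?_ h2
    have h3 : (C ^ 60)⁻¹ ^ (6 * l) = Real.exp (-(6 * a * l)) := by
      rw [← Real.exp_log (show 0 < C ^ 60 by positivity), ← ha, ← Real.exp_neg, ← Real.exp_nat_mul]
      congr 1
      push_cast
      ring
    rw [h3, show Real.exp (-(6 * a * l)) / 2 = 1 / 2 * Real.exp (-(6 * a * l)) by ring]
    refine mul_le_mul (min_le_left _ _) (Real.exp_le_exp.2 ?_) (Real.exp_pos _).le (by norm_num)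
    nlinarith [mul_nonneg hb0 (Nat.cast_nonneg (α := ℝ) l)]
  · have h2 := hp.exitProb_ge_rpow h0 h1 hpp (x := x) hR hn
    refine le_trans ?_ h2
    have h3 : p₀ ^ R = Real.exp (-(b * R)) := by
      rw [Real.rpow_def_of_pos h0, hb]
      congr 1
      ring
    rw [h3]
    refine mul_le_mul (min_le_right _ _) (Real.exp_le_exp.2 ?_) (Real.exp_pos _).le h0.le
    have h4 := mul_le_mul_of_nonneg_left (not_le.1 hl).le hb0
    simp only [neg_mul]
    nlinarith [mul_nonneg ha0 hl0]

end

end WeightedGraph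

end

theorem theorem3p1 {V : Type*} [Infinite V] [MeasurableSpace V] [DiscreteMeasurableSpace V]
    (G : WeightedGraph V) (hp : G.P0) :
    (G.EbarCondition →
      ∃ q : ℝ≥0, 0 < q ∧ ∃ c : ℝ, 0 < c ∧ ∃ C : ℝ, 0 < C ∧
        ∀ (x : V) (R : ℝ) (n : ℕ), 0 < R → R ≤ n →
          (G.law x).real {ω | WeightedGraph.exitTime (G.ball x R) ω < n} ≤
            C * Real.exp (-c * G.k q x n R)) ∧
    (G.EllipticHarnack →
      ∃ Q : ℝ≥0, 0 < Q ∧ ∃ c : ℝ, 0 < c ∧ ∃ C : ℝ, 0 < C ∧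
        ∀ (x : V) (R : ℝ) (n : ℕ), 0 < R → (∃ m : ℕ, 2 * R = m) → R + 1 ≤ n →
          c * Real.exp (-C * G.nu Q x n R) ≤
            (G.law x).real {ω | WeightedGraph.exitTime (G.ball x R) ω < n}) := by
  exact ⟨fun h => h.exitProb_le hp, fun h => h.exitProb_ge hp⟩
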